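/- **Formulas and frames.** Fix a nonempty set of propositions. Formulas are $A ::= p \mid \bar p \mid A\vee A \mid A\wedge A \mid \Diamond A \mid \Box A$, with the usual Kripke semantics on frames $(S,\to)$, $S\neq\emptyset$; $\bot$ is $p\wedge\bar p$ for a fixed $p$. The names $\mathsf{d},\mathsf{t},\mathsf{b},\mathsf{4},\mathsf{5}$ stand for the frame conditions serial, reflexive, symmetric, transitive, euclidean ($s\to t$ and $s\to u$ imply $t\to u$). For $\mathsf X\subseteq\{\mathsf{d,t,b,4,5}\}$ an $\mathsf X$-frame is a frame that satisfies all conditions in $\mathsf X$; *$\mathsf X$-valid* means valid in all $\mathsf X$-frames. $\mathsf X$ is *45-closed* if for $\rho\in\{\mathsf 4,\mathsf 5\}$: if all $\mathsf X$-frames satisfy $\rho$, then $\rho\in\mathsf X$. **Sequents.** A (nested) sequent is a finite multiset $A_1,\dots,A_m,[\Delta_1],\dots,[\Delta_n]$ of formulas and boxed sequents (the comma is multiset union); its corresponding formula is the disjunction of the $A_i$ and of $\Box$ applied to the corresponding formulas of the $\Delta_j$ ($\bot$ if $m=n=0$), and a sequent is valid in a frame iff its corresponding formula is. A sequent is also a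 finite tree: the root carries $A_1,\dots,A_m$ and its children are the roots of the trees of $\Delta_1,\dots,\Delta_n$. $\Gamma\{\ \}$ and $\Gamma\{\ \}\{\ \}$ denote sequents with one or two holes, which may occur in any node; the depth of a hole is the number of brackets around it. **The system $\mathsf K+\Diamond\mathsf X_{\mathsf c}$.** Proofs are finite trees with leaves $\Gamma\{p,\bar p\}$ (the *axiomatic* sequents), built with the rules (premises / conclusion) - $\wedge$: $\Gamma\{A\}$ and $\Gamma\{B\}$ / $\Gamma\{A\wedge B\}$; - $\vee$: $\Gamma\{A,B\}$ / $\Gamma\{A\vee B\}$; - $\Box$: $\Gamma\{[A]\}$ / $\Gamma\{\Box A\}$; - $\Diamond\mathsf{k_c}$: $\Gamma\{\Diamond A,[\Delta,A]\}$ / $\Gamma\{\Diamond A,[\Delta]\}$; and, for each $\rho\in\mathsf X$, the rule $\Diamond\rho_{\mathsf c}$ among - $\Diamond\mathsf{d_c}$: $\Gamma\{\Diamond A,[A]\}$ / $\Gamma\{\Diamond A\}$; - $\Diamond\mathsf{t_c}$: $\Gamma\{\Diamond A,A\}$ / $\Gamma\{\Diamond A\}$; - $\Diamond\mathsf{b_c}$: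 $\Gamma\{[\Delta,\Diamond A],A\}$ / $\Gamma\{[\Delta,\Diamond A]\}$; - $\Diamond\mathsf{4_c}$: $\Gamma\{\Diamond A,[\Delta,\Diamond A]\}$ / $\Gamma\{\Diamond A,[\Delta]\}$; - $\Diamond\mathsf{5_c}$: $\Gamma\{\Diamond A\}\{\Diamond A\}$ / $\Gamma\{\Diamond A\}\{\emptyset\}$, where the first hole has depth $>0$. **The procedure $\mathit{prove}(\Gamma,\mathsf X)$.** For each rule $\rho$ let $\rho^\circ$ be the rule with the same conclusions in which the premises of $\wedge,\vee,\Box$ are replaced by $\Gamma\{A\wedge B,A\}$ and $\Gamma\{A\wedge B,B\}$, by $\Gamma\{A\vee B,A,B\}$ and by $\Gamma\{\Box A,[A]\}$; $\Box^\circ$ applies only if in the conclusion no child of the node of the active formula contains $A$, $\Diamond\mathsf{d_c}^\circ$ only if that node has no child; and every $\rho^\circ$ applies only if in each premise, compared with the conclusion, there is a new node or some node carries a strictly larger set of formulas. A leaf of a sequent is *cyclic* if some inner node of the sequent carries the same set of formulas. A sequent is *finished* if no rule $\rho^\circ$ of the system other than $\Box^\circ,\Diamond\mathsf{d_c}^\circ$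 applies to it and each of its nodes is a cyclic leaf or has no formula to which $\Box^\circ$ or, if $\mathsf d\in\mathsf X$, $\Diamond\mathsf{d_c}^\circ$ applies. The procedure starts with the derivation that consists of $\Gamma$ only, and extends the derivation bottom-up at its non-axiomatic unfinished leaves, repeating (step 1) apply the rules $\rho^\circ$ other than $\Box^\circ,\Diamond\mathsf{d_c}^\circ$ as long as possible; (step 2) apply $\Box^\circ$ and, if $\mathsf d\in\mathsf X$, $\Diamond\mathsf{d_c}^\circ$ once wherever possible (in the nodes present at the beginning of step 2), until each non-axiomatic derivation leaf is finished. The order of the rule applications is arbitrary. It *fails* if it terminates with a non-axiomatic derivation leaf. **Theorem (Completeness).** Let $\mathsf X\subseteq\{\mathsf{d,t,b,4,5}\}$ be 45-closed and let $\Gamma$ be a sequent. (i) If $\Gamma$ is $\mathsf X$-valid, then $\Gamma$ is provable in $\mathsf K+\Diamond\mathsf X_{\mathsf c}$. (ii) If (some run of) $\mathit{prove}(\Gamma,\mathsf X)$ fails, then there is a finite $\mathsf X$-frame in which $\Gamma$ is not valid. -/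

import Mathlib

universe u v

namespace NestedSequents

/-! ### Formulas and Kripke semantics -/

/-- Modal formulas in negation normal form over a type `P` of propositions. -/
inductive Formula (P : Type u) : Type u
  | pos (p : P) : Formula P
  | neg (p : P) : Formula P
  | or (A B : Formula P) : Formula P
  | and (A B : Formula P) : Formula P
  | dia (A : Formula P) : Formula P
  | box (A : Formula P) : Formula P

namespace Formula

/-- `⊥` is `p ∧ ¬p` for some fixed proposition `p`. -/
noncomputable def bot {P : Type u} [Nonempty P] : Formula P :=
  .and (.pos (Classical.arbitrary P)) (.neg (Classical.arbitrary P))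

/-- Left-associated disjunction of a list of formulas; `⊥` for the empty list. -/
noncomputable def disj {P : Type u} [Nonempty P] : List (Formula P) → Formula P
  | [] => bot
  | A :: l => l.foldl Formula.or A

/-- `s ⊨ A` in the model with states `S`, relation `R` and valuation `V`. -/
def Holds {P : Type u} {S : Type v} (R : S → S → Prop) (V : P → Set S) : S → Formula P → Prop
  | s, .pos p => s ∈ V p
  | s, .neg p => s ∉ V p
  | s, .or A B => Holds R V s A ∨ Holds R V s B
  | s, .and A B => Holds R V s A ∧ Holds R V s B
  | s, .dia A => ∃ t, R s t ∧ Holds R V t A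
  | s, .box A => ∀ t, R s t → Holds R V t A

/-- Validity of a formula in the frame `(S, R)`. -/
def ValidInFrame {P : Type u} {S : Type v} (R : S → S → Prop) (A : Formula P) : Prop :=
  ∀ (V : P → Set S) (s : S), Holds R V s A

end Formula

/-- The names of the modal axioms `d, t, b, 4, 5`. -/
inductive ModalAxiom : Type
  | d | t | b | four | five

/-- The frame condition of a modal axiom: seriality, reflexivity, symmetry, transitivity,
euclideanness. -/
def ModalAxiom.FrameCondition {S : Type v} (R : S → S → Prop) : ModalAxiom → Prop
  | .d => ∀ s, ∃ t, R s t
  | .t => ∀ s, R s s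
  | .b => ∀ s t, R s t → R t s
  | .four => ∀ s t w, R s t → R t w → R s w
  | .five => ∀ s t w, R s t → R s w → R t w

/-- `(S, R)` satisfies all the frame conditions in `X`. -/
def IsFrame (X : Set ModalAxiom) {S : Type v} (R : S → S → Prop) : Prop :=
  ∀ a ∈ X, a.FrameCondition R

/-- `X` is 45-closed: for `ρ ∈ {4, 5}`, if all `X`-frames satisfy `ρ` then `ρ ∈ X`. -/
def FourFiveClosed (X : Set ModalAxiom) : Prop :=
  ∀ ρ : ModalAxiom, ρ = .four ∨ ρ = .five →
    (∀ (S : Type v) [Nonempty S] (R : S → S → Prop), IsFrame X R → ρ.FrameCondition R) → ρ ∈ X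

/-! ### Nested sequents -/

/-- Expressions for nested sequents, built from formulas by union and brackets. -/
inductive PreSequent (P : Type u) : Type u
  | empty : PreSequent P
  | single (A : Formula P) : PreSequent P
  | union (Γ Δ : PreSequent P) : PreSequent P
  | bracket (Γ : PreSequent P) : PreSequent P

namespace PreSequent

/-- Two expressions denote the same nested multiset: the congruence generated by the laws of
multiset union. -/
inductive Same {P : Type u} : PreSequent P → PreSequent P → Prop
  | refl (Γ) : Same Γ Γ
  | symm {Γ Δ} : Same Γ Δ → Same Δ Γ
  | trans {Γ Δ Λ} : Same Γ Δ → Same Δ Λ → Same Γ Λ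
  | union {Γ Γ' Δ Δ'} : Same Γ Γ' → Same Δ Δ' → Same (.union Γ Δ) (.union Γ' Δ')
  | bracket {Γ Γ'} : Same Γ Γ' → Same (.bracket Γ) (.bracket Γ')
  | empty_union (Γ) : Same (.union .empty Γ) Γ
  | comm (Γ Δ) : Same (.union Γ Δ) (.union Δ Γ)
  | assoc (Γ Δ Λ) : Same (.union (.union Γ Δ) Λ) (.union Γ (.union Δ Λ))

instance setoid (P : Type u) : Setoid (PreSequent P) where
  r := Same
  iseqv := ⟨Same.refl, Same.symm, Same.trans⟩

end PreSequent

/-- Nested sequents: finite multisets of formulas and boxed sequents. The sum of sequents is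
multiset union (the comma). -/
def Sequent (P : Type u) : Type u := Quotient (PreSequent.setoid P)

namespace Sequent

variable {P : Type u}

/-- The sequent consisting of one formula. -/
def single (A : Formula P) : Sequent P := Quotient.mk _ (.single A)

/-- The sequent `[Γ]`. -/
def bracket : Sequent P → Sequent P :=
  Quotient.map PreSequent.bracket fun _ _ h => .bracket h

instance : Zero (Sequent P) := ⟨Quotient.mk _ .empty⟩

instance : Add (Sequent P) :=
  ⟨Quotient.map₂ PreSequent.union fun _ _ h _ _ h' => .union h h'⟩

instance : AddCommMonoid (Sequent P) where
  add_assoc := by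
    rintro ⟨a⟩ ⟨b⟩ ⟨c⟩
    exact Quotient.sound (PreSequent.Same.assoc a b c)
  add_comm := by
    rintro ⟨a⟩ ⟨b⟩
    exact Quotient.sound (PreSequent.Same.comm a b)
  zero_add := by
    rintro ⟨a⟩
    exact Quotient.sound (PreSequent.Same.empty_union a)
  add_zero := by
    rintro ⟨a⟩
    exact Quotient.sound ((PreSequent.Same.comm _ _).trans (PreSequent.Same.empty_union a))
  nsmul := nsmulRec

/-- Induction over sequents. -/
theorem induction {motive : Sequent P → Prop} (zero : motive 0)
    (single : ∀ A, motive (single A)) (add : ∀ Γ Δ, motive Γ → motive Δ → motive (Γ + Δ))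
    (bracket : ∀ Γ, motive Γ → motive (bracket Γ)) (Γ : Sequent P) : motive Γ := by
  obtain ⟨t⟩ := Γ
  induction t with
  | empty => exact zero
  | single A => exact single A
  | union Γ Δ h h' => exact add _ _ h h'
  | bracket Γ h => exact bracket _ h

/-- The formulas at the root of an expression. -/
def preFormulas : PreSequent P → Multiset (Formula P)
  | .empty => 0
  | .single A => {A}
  | .union Γ Δ => preFormulas Γ + preFormulas Δ
  | .bracket _ => 0

theorem preFormulas_congr {Γ Δ : PreSequent P} (h : PreSequent.Same Γ Δ) :
    preFormulas Γ = preFormulas Δ := by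
  induction h with
  | refl => rfl
  | symm _ h => exact h.symm
  | trans _ _ h h' => exact h.trans h'
  | union _ _ h h' => simp [preFormulas, h, h']
  | bracket => rfl
  | empty_union => simp [preFormulas]
  | comm => simp [preFormulas, add_comm]
  | assoc => simp [preFormulas, add_assoc]

/-- The formulas `A₁, …, Aₘ` of `Γ = A₁, …, Aₘ, [Δ₁], …, [Δₙ]`, the label of its root. -/
def formulas : Sequent P → Multiset (Formula P) :=
  Quotient.lift preFormulas fun _ _ h => preFormulas_congr h

/-- The immediate subtrees of an expression. -/
def preChildren : PreSequent P → Multiset (Sequent P)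
  | .empty => 0
  | .single _ => 0
  | .union Γ Δ => preChildren Γ + preChildren Δ
  | .bracket Γ => {Quotient.mk _ Γ}

theorem preChildren_congr {Γ Δ : PreSequent P} (h : PreSequent.Same Γ Δ) :
    preChildren Γ = preChildren Δ := by
  induction h with
  | refl => rfl
  | symm _ h => exact h.symm
  | trans _ _ h h' => exact h.trans h'
  | union _ _ h h' => simp [preChildren, h, h']
  | bracket h _ => simp only [preChildren]; rw [Quotient.sound h]
  | empty_union => simp [preChildren]
  | comm => simp [preChildren, add_comm]
  | assoc => simp [preChildren, add_assoc]

/-- The immediate subtrees `Δ₁, …, Δₙ` of `Γ = A₁, …, Aₘ, [Δ₁], …, [Δₙ]`. -/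
def children : Sequent P → Multiset (Sequent P) :=
  Quotient.lift preChildren fun _ _ h => preChildren_congr h

@[simp] theorem formulas_zero : (0 : Sequent P).formulas = 0 := rfl
@[simp] theorem formulas_single (A : Formula P) : (single A).formulas = {A} := rfl
@[simp] theorem formulas_add (Γ Δ : Sequent P) :
    (Γ + Δ).formulas = Γ.formulas + Δ.formulas := by
  obtain ⟨t⟩ := Γ; obtain ⟨t'⟩ := Δ; rfl
@[simp] theorem formulas_bracket (Γ : Sequent P) : (bracket Γ).formulas = 0 := by
  obtain ⟨t⟩ := Γ; rfl
@[simp] theorem children_zero : (0 : Sequent P).children = 0 := rfl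
@[simp] theorem children_single (A : Formula P) : (single A).children = 0 := rfl
@[simp] theorem children_add (Γ Δ : Sequent P) :
    (Γ + Δ).children = Γ.children + Δ.children := by
  obtain ⟨t⟩ := Γ; obtain ⟨t'⟩ := Δ; rfl
@[simp] theorem children_bracket (Γ : Sequent P) : (bracket Γ).children = {Γ} := by
  obtain ⟨t⟩ := Γ; rfl

/-- The sequent `A₁, …, Aₘ, [Δ₁], …, [Δₙ]`. -/
def ofParts (As : Multiset (Formula P)) (Δs : Multiset (Sequent P)) : Sequent P :=
  (As.map single).sum + (Δs.map bracket).sum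

/-- Every sequent is of the form `A₁, …, Aₘ, [Δ₁], …, [Δₙ]`. -/
theorem ofParts_formulas_children (Γ : Sequent P) : ofParts Γ.formulas Γ.children = Γ := by
  induction Γ using Sequent.induction with
  | zero => simp [ofParts]
  | single A => simp [ofParts]
  | add Γ Δ h h' =>
    conv_rhs => rw [← h, ← h']
    simp only [ofParts, formulas_add, children_add, Multiset.map_add, Multiset.sum_add]
    exact add_add_add_comm _ _ _ _
  | bracket Γ => simp [ofParts]

/-- The number of formulas and brackets in an expression. -/
def preWeight : PreSequent P → ℕ
  | .empty => 0
  | .single _ => 1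
  | .union Γ Δ => preWeight Γ + preWeight Δ
  | .bracket Γ => preWeight Γ + 1

theorem preWeight_congr {Γ Δ : PreSequent P} (h : PreSequent.Same Γ Δ) :
    preWeight Γ = preWeight Δ := by
  induction h with
  | refl => rfl
  | symm _ h => exact h.symm
  | trans _ _ h h' => exact h.trans h'
  | union _ _ h h' => simp [preWeight, h, h']
  | bracket _ h => simp [preWeight, h]
  | empty_union => simp [preWeight]
  | comm => simp [preWeight, add_comm]
  | assoc => simp [preWeight, add_assoc]

/-- The number of formulas and brackets in a sequent; used only as a termination measure. -/
def weight : Sequent P → ℕ := Quotient.lift preWeight fun _ _ h => preWeight_congr h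

theorem weight_lt_of_mem_children {Γ Δ : Sequent P} (h : Δ ∈ Γ.children) :
    Δ.weight < Γ.weight := by
  obtain ⟨t⟩ := Γ
  have h' : Δ ∈ preChildren t := h
  change Δ.weight < preWeight t
  clear h
  induction t with
  | empty => simp [preChildren] at h'
  | single A => simp [preChildren] at h'
  | union s t hs ht =>
    simp only [preChildren, Multiset.mem_add] at h'
    simp only [preWeight]
    rcases h' with h' | h'
    · have := hs h'; omega
    · have := ht h'; omega
  | bracket t =>
    obtain rfl : Δ = Quotient.mk _ t := Multiset.mem_singleton.1 h'
    exact Nat.lt_succ_self _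

/-- The corresponding formula of `A₁, …, Aₘ, [Δ₁], …, [Δₙ]`: the disjunction of the `Aᵢ` and of
the `□` of the corresponding formulas of the `Δⱼ`, each listed in a fixed order. -/
noncomputable def toFormula [Nonempty P] (Γ : Sequent P) : Formula P :=
  Formula.disj (Γ.formulas.toList ++
    Γ.children.toList.attach.map fun Δ => Formula.box (toFormula Δ.1))
termination_by Γ.weight
decreasing_by exact weight_lt_of_mem_children (Multiset.mem_toList.1 Δ.2)

/-- A sequent is valid in a frame if its corresponding formula is. -/
def ValidInFrame [Nonempty P] {S : Type v} (R : S → S → Prop) (Γ : Sequent P) : Prop :=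
  Γ.toFormula.ValidInFrame R

/-- `X`-validity: validity in all `X`-frames. -/
def IsValid [Nonempty P] (X : Set ModalAxiom) (Γ : Sequent P) : Prop :=
  ∀ (S : Type v) [Nonempty S] (R : S → S → Prop), IsFrame X R → Γ.ValidInFrame R

/-- `Δ.SubtreeOf Γ`: `Δ` is a subtree of `Γ`, i.e. the subtree at some node of the tree of `Γ`. -/
inductive SubtreeOf : Sequent P → Sequent P → Prop
  | refl (Γ) : SubtreeOf Γ Γ
  | child {Γ Λ Δ} : Λ ∈ Γ.children → SubtreeOf Δ Λ → SubtreeOf Δ Γ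

end Sequent

/-! ### Contexts -/

/-- Unary contexts: `{ }`, or `Γ, C{ }`, or `[C{ }]`. -/
inductive Ctx (P : Type u) : Type u
  | hole : Ctx P
  | add (Γ : Sequent P) (C : Ctx P) : Ctx P
  | bracket (C : Ctx P) : Ctx P

namespace Ctx

variable {P : Type u}

/-- The sequent `C{Δ}`. -/
def fill : Ctx P → Sequent P → Sequent P
  | .hole, Δ => Δ
  | .add Γ C, Δ => Γ + C.fill Δ
  | .bracket C, Δ => (C.fill Δ).bracket

/-- The number of brackets around the hole. -/
def depth : Ctx P → ℕ
  | .hole => 0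
  | .add _ C => C.depth
  | .bracket C => C.depth + 1

/-- What stands next to the hole in its node: the subtree of `C{Δ}` at the node of the hole is
`C.beside + Δ`. -/
def beside : Ctx P → Sequent P
  | .hole => 0
  | .add Γ C => if C.depth = 0 then Γ + C.beside else C.beside
  | .bracket C => C.beside

end Ctx

/-- Binary contexts `C{ }{ }`: the two holes lie in different summands (`fork C D` is the context
`C{ }, D{ }`, first hole in `C`, second in `D`), or there is a sequent next to a binary context,
or brackets around one. -/
inductive Ctx₂ (P : Type u) : Type u
  | fork (C D : Ctx P) : Ctx₂ P
  | add (Γ : Sequent P) (C : Ctx₂ P) : Ctx₂ P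
  | bracket (C : Ctx₂ P) : Ctx₂ P

namespace Ctx₂

variable {P : Type u}

/-- The unary context `C{Δ}{ }`. -/
def fillFst : Ctx₂ P → Sequent P → Ctx P
  | .fork C D, Δ => .add (C.fill Δ) D
  | .add Γ C, Δ => .add Γ (C.fillFst Δ)
  | .bracket C, Δ => .bracket (C.fillFst Δ)

/-- The unary context `C{ }{Δ}`. -/
def fillSnd : Ctx₂ P → Sequent P → Ctx P
  | .fork C D, Δ => .add (D.fill Δ) C
  | .add Γ C, Δ => .add Γ (C.fillSnd Δ)
  | .bracket C, Δ => .bracket (C.fillSnd Δ)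

/-- The sequent `C{Δ}{Λ}`. -/
def fill (C : Ctx₂ P) (Δ Λ : Sequent P) : Sequent P := (C.fillFst Δ).fill Λ

theorem fill_eq (C : Ctx₂ P) (Δ Λ : Sequent P) : C.fill Δ Λ = (C.fillSnd Λ).fill Δ := by
  unfold fill
  induction C with
  | fork C D => simp only [fillFst, fillSnd, Ctx.fill]; exact add_comm _ _
  | add Γ C h => simp only [fillFst, fillSnd, Ctx.fill, h]
  | bracket C h => simp only [fillFst, fillSnd, Ctx.fill, h]

end Ctx₂

/-! ### The sequent systems -/

/-- Names of rules: `∧, ∨, □, ◇k_c`, and `◇ρ_c` for each modal axiom `ρ`. -/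
inductive RuleName : Type
  | and | or | box | k
  | modal (ρ : ModalAxiom)

/-- The rule names of the system `K + ◇X_c`. -/
def system (X : Set ModalAxiom) : Set RuleName :=
  {.and, .or, .box, .k} ∪ RuleName.modal '' X

open Sequent (single bracket)

/-- `Γ` is an instance `Γ'{p, ¬p}` of the axiom. -/
def Axiomatic {P : Type u} (Γ : Sequent P) : Prop :=
  ∃ (C : Ctx P) (p : P), Γ = C.fill (single (.pos p) + single (.neg p))

/-- `Instance ρ Γ Γs`: from the premises `Γs` infer the conclusion `Γ` by the rule `ρ`. -/
inductive Instance {P : Type u} : RuleName → Sequent P → List (Sequent P) → Prop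
  | and (C : Ctx P) (A B : Formula P) :
      Instance .and (C.fill (single (A.and B))) [C.fill (single A), C.fill (single B)]
  | or (C : Ctx P) (A B : Formula P) :
      Instance .or (C.fill (single (A.or B))) [C.fill (single A + single B)]
  | box (C : Ctx P) (A : Formula P) :
      Instance .box (C.fill (single A.box)) [C.fill (bracket (single A))]
  | k (C : Ctx P) (A : Formula P) (Δ : Sequent P) :
      Instance .k (C.fill (single A.dia + bracket Δ))
        [C.fill (single A.dia + bracket (Δ + single A))]
  | d (C : Ctx P) (A : Formula P) :
      Instance (.modal .d) (C.fill (single A.dia)) [C.fill (single A.dia + bracket (single A))]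
  | t (C : Ctx P) (A : Formula P) :
      Instance (.modal .t) (C.fill (single A.dia)) [C.fill (single A.dia + single A)]
  | b (C : Ctx P) (A : Formula P) (Δ : Sequent P) :
      Instance (.modal .b) (C.fill (bracket (Δ + single A.dia)))
        [C.fill (bracket (Δ + single A.dia) + single A)]
  | four (C : Ctx P) (A : Formula P) (Δ : Sequent P) :
      Instance (.modal .four) (C.fill (single A.dia + bracket Δ))
        [C.fill (single A.dia + bracket (Δ + single A.dia))]
  | five (C : Ctx₂ P) (A : Formula P) (hC : 0 < (C.fillSnd 0).depth) :
      Instance (.modal .five) (C.fill (single A.dia) 0) [C.fill (single A.dia) (single A.dia)]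

/-- `K + ◇X_c ⊢ Γ`: there is a finite derivation of `Γ` all of whose leaves are axioms. -/
inductive Provable {P : Type u} (X : Set ModalAxiom) : Sequent P → Prop
  | ax {Γ : Sequent P} : Axiomatic Γ → Provable X Γ
  | rule {ρ : RuleName} {Γ : Sequent P} {Γs : List (Sequent P)} :
      ρ ∈ system X → Instance ρ Γ Γs → (∀ Δ ∈ Γs, Provable X Δ) → Provable X Γ

/-! ### The proof search procedure -/

/-- Side condition of `□°` for the active formula `□A` in the root of `Δ`: no child node
contains `A`. -/
def BoxApplies {P : Type u} (Δ : Sequent P) (A : Formula P) : Prop :=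
  A.box ∈ Δ.formulas ∧ ∀ Λ ∈ Δ.children, A ∉ Λ.formulas

/-- Side condition of `◇d_c°` for the active formula `◇A` in the root of `Δ`: there is no child
node. -/
def DiaDApplies {P : Type u} (Δ : Sequent P) (A : Formula P) : Prop :=
  A.dia ∈ Δ.formulas ∧ Δ.children = 0

/-- Instances of the rules `ρ°`. They keep the main formula, and carry the proviso that in each
premise there is a new node or a node whose set of formulas has grown. For `□°` and `◇d_c°`,
which create a node, this is automatic. -/
inductive InstanceO {P : Type u} : RuleName → Sequent P → List (Sequent P) → Prop
  | and (C : Ctx P) (A B : Formula P)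
      (hA : A ∉ (C.beside + single (A.and B)).formulas)
      (hB : B ∉ (C.beside + single (A.and B)).formulas) :
      InstanceO .and (C.fill (single (A.and B)))
        [C.fill (single (A.and B) + single A), C.fill (single (A.and B) + single B)]
  | or (C : Ctx P) (A B : Formula P)
      (h : A ∉ (C.beside + single (A.or B)).formulas ∨ B ∉ (C.beside + single (A.or B)).formulas) :
      InstanceO .or (C.fill (single (A.or B))) [C.fill (single (A.or B) + single A + single B)]
  | box (C : Ctx P) (A : Formula P) (h : BoxApplies (C.beside + single A.box) A) :
      InstanceO .box (C.fill (single A.box)) [C.fill (single A.box + bracket (single A))]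
  | k (C : Ctx P) (A : Formula P) (Δ : Sequent P) (h : A ∉ Δ.formulas) :
      InstanceO .k (C.fill (single A.dia + bracket Δ))
        [C.fill (single A.dia + bracket (Δ + single A))]
  | d (C : Ctx P) (A : Formula P) (h : DiaDApplies (C.beside + single A.dia) A) :
      InstanceO (.modal .d) (C.fill (single A.dia)) [C.fill (single A.dia + bracket (single A))]
  | t (C : Ctx P) (A : Formula P) (h : A ∉ (C.beside + single A.dia).formulas) :
      InstanceO (.modal .t) (C.fill (single A.dia)) [C.fill (single A.dia + single A)]
  | b (C : Ctx P) (A : Formula P) (Δ : Sequent P) (h : A ∉ C.beside.formulas) :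
      InstanceO (.modal .b) (C.fill (bracket (Δ + single A.dia)))
        [C.fill (bracket (Δ + single A.dia) + single A)]
  | four (C : Ctx P) (A : Formula P) (Δ : Sequent P) (h : A.dia ∉ Δ.formulas) :
      InstanceO (.modal .four) (C.fill (single A.dia + bracket Δ))
        [C.fill (single A.dia + bracket (Δ + single A.dia))]
  | five (C : Ctx₂ P) (A : Formula P) (hC : 0 < (C.fillSnd 0).depth)
      (h : A.dia ∉ (C.fillFst (single A.dia)).beside.formulas) :
      InstanceO (.modal .five) (C.fill (single A.dia) 0) [C.fill (single A.dia) (single A.dia)]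

/-- The rules applied in step 1: all rules of `(K + ◇X_c)°` except `□°` and `◇d_c°`. -/
def InstanceStep1 {P : Type u} (X : Set ModalAxiom) (Γ : Sequent P) (Γs : List (Sequent P)) :
    Prop :=
  ∃ ρ ∈ system X, ρ ≠ .box ∧ ρ ≠ .modal .d ∧ InstanceO ρ Γ Γs

/-- The subtree `Δ` of `Γ` is a cyclic leaf: it is a leaf and some inner node of `Γ` carries the
same set of formulas. -/
def CyclicLeaf {P : Type u} (Γ Δ : Sequent P) : Prop :=
  Δ.children = 0 ∧ ∃ Λ : Sequent P, Λ.SubtreeOf Γ ∧ Λ.children ≠ 0 ∧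
    ∀ A, A ∈ Λ.formulas ↔ A ∈ Δ.formulas

/-- `Γ` is finished: no rule of step 1 applies to it, and each of its nodes is a cyclic leaf or
such that neither `□°` nor (if present) `◇d_c°` applies to a formula in it. -/
def Finished {P : Type u} (X : Set ModalAxiom) (Γ : Sequent P) : Prop :=
  (∀ Γs, ¬ InstanceStep1 X Γ Γs) ∧
    ∀ Δ : Sequent P, Δ.SubtreeOf Γ → CyclicLeaf Γ Δ ∨
      (∀ A, ¬ BoxApplies Δ A) ∧ (ModalAxiom.d ∈ X → ∀ A, ¬ DiaDApplies Δ A)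

/-- One extension of a derivation in step 1, described by the multisets of derivation leaves
before and after: a step 1 rule is applied (bottom-up) to a non-axiomatic unfinished leaf. -/
def Step1 {P : Type u} (X : Set ModalAxiom) (L L' : Multiset (Sequent P)) : Prop :=
  ∃ (Γ : Sequent P) (Γs : List (Sequent P)) (L₀ : Multiset (Sequent P)),
    L = Γ ::ₘ L₀ ∧ ¬ Axiomatic Γ ∧ ¬ Finished X Γ ∧ InstanceStep1 X Γ Γs ∧
      L' = (Γs : Multiset (Sequent P)) + L₀

/-- Step 1 as a whole: the rules of step 1 are applied as long as possible. -/
def Phase1 {P : Type u} (X : Set ModalAxiom) (L L' : Multiset (Sequent P)) : Prop :=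
  Relation.ReflTransGen (Step1 X) L L' ∧ ∀ L'', ¬ Step1 X L' L''

/-- One application (bottom-up) of `□°` or, if `d ∈ X`, of `◇d_c°` to a formula in the root of a
sequent. -/
def ExpandRoot {P : Type u} (X : Set ModalAxiom) (Δ Δ' : Sequent P) : Prop :=
  ∃ A, (BoxApplies Δ A ∨ ModalAxiom.d ∈ X ∧ DiaDApplies Δ A) ∧ Δ' = Δ + bracket (single A)

/-- `Expand X Γ Γ'`: the premise `Γ'` arises from `Γ` by applying `□°` and `◇d_c°` once wherever
possible, i.e. in each node of `Γ` as long as they apply there, but not in the nodes created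
meanwhile. -/
inductive Expand {P : Type u} (X : Set ModalAxiom) : Sequent P → Sequent P → Prop
  | node {As : Multiset (Formula P)} {Δs Δs' : Multiset (Sequent P)} {Γ' : Sequent P} :
      Multiset.Rel (Expand X) Δs Δs' →
      Relation.ReflTransGen (ExpandRoot X) (Sequent.ofParts As Δs') Γ' →
      (∀ Γ'', ¬ ExpandRoot X Γ' Γ'') →
      Expand X (Sequent.ofParts As Δs) Γ'

/-- Step 2 as a whole: every non-axiomatic unfinished derivation leaf is expanded. -/
def Phase2 {P : Type u} (X : Set ModalAxiom) (L L' : Multiset (Sequent P)) : Prop :=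
  Multiset.Rel (fun Γ Γ' => (Axiomatic Γ ∨ Finished X Γ) ∧ Γ' = Γ ∨
    (¬ Axiomatic Γ ∧ ¬ Finished X Γ) ∧ Expand X Γ Γ') L L'

/-- The exit condition of the loop: each non-axiomatic derivation leaf is finished. -/
def Done {P : Type u} (X : Set ModalAxiom) (L : Multiset (Sequent P)) : Prop :=
  ∀ Γ ∈ L, ¬ Axiomatic Γ → Finished X Γ

/-- `Run X L L'`: the loop "repeat step 1; step 2 until done", started on a derivation with
leaves `L`, can terminate with a derivation with leaves `L'`. -/
inductive Run {P : Type u} (X : Set ModalAxiom) :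
    Multiset (Sequent P) → Multiset (Sequent P) → Prop
  | last {L L₁ L₂} : Phase1 X L L₁ → Phase2 X L₁ L₂ → Done X L₂ → Run X L L₂
  | again {L L₁ L₂ L'} : Phase1 X L L₁ → Phase2 X L₁ L₂ → ¬ Done X L₂ → Run X L₂ L' → Run X L L'

/-- `prove(Γ, X)` fails: it terminates with a derivation that has a non-axiomatic leaf. The order
of the rule applications is left open, so this says that some run fails. -/
def ProveFails {P : Type u} (X : Set ModalAxiom) (Γ : Sequent P) : Prop :=
  ∃ L, Run X {Γ} L ∧ ∃ Δ ∈ L, ¬ Axiomatic Δ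

end NestedSequents

namespace NestedSequents

open Sequent (single bracket)

/-! ### Maps between trees of sequents -/

namespace Sequent

variable {P : Type u} {T : Type*}

/-! Both parts rest on one countermodel construction, `exists_countermodel`, for a non-axiomatic
sequent to which no rule of step 1 applies. The states stand for sets of formulas carried by its
nodes, and every formula in such a label is false at its state. The tree edges are not closed under
the conditions in `X`; instead two labels are related as soon as they meet the constraints that the
diamond rules impose along an edge (`LabelRel`). Tree edges meet these constraints, so boxes have
their witnesses, and diamonds are false by the definition of the relation. The frame conditions
follow from the constraints: under 5 a diamond in a node other than the root is in every node, and
45-closedness supplies 4 or 5 where a combination of axioms forces it.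

For (ii), a failing run leaves a finished non-axiomatic leaf. Search only adds formulas and nodes,
so the initial sequent embeds into this leaf. All labels of the leaf are used; the label of a cyclic
leaf is represented by the inner node that shares it.

For (i), termination of the procedure is not needed. An unprovable sequent is extended by passing to
unprovable premises of the rules `ρ°`, expanding only nodes of bounded depth; a numerical
`potential` decreases (`exists_saturated_of_not_provable`). The sets of labels found down to a given
depth increase inside a finite power set, so two consecutive ones agree before the bound is reached.
At that depth the labels of children are not new, and these labels carry the countermodel.

Passing to premises of `ρ°` requires weakening, contraction and inversion. `Provable.of_hom` gives
them together, by transporting derivations along maps of trees under which a formula may be replaced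
by its decomposition. -/

theorem exists_eq_add_single {Γ : Sequent P} {A : Formula P} (h : A ∈ Γ.formulas) :
    ∃ Δ, Γ = Δ + single A := by
  obtain ⟨As, hAs⟩ := Multiset.exists_cons_of_mem h
  refine ⟨ofParts As Γ.children, ?_⟩
  conv_lhs => rw [← ofParts_formulas_children Γ, hAs]
  simp only [ofParts, Multiset.map_cons, Multiset.sum_cons]
  abel

theorem exists_eq_add_bracket {Γ Λ : Sequent P} (h : Λ ∈ Γ.children) :
    ∃ Δ, Γ = Δ + bracket Λ := by
  obtain ⟨Λs, hΛs⟩ := Multiset.exists_cons_of_mem h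
  refine ⟨ofParts Γ.formulas Λs, ?_⟩
  conv_lhs => rw [← ofParts_formulas_children Γ, hΛs]
  simp only [ofParts, Multiset.map_cons, Multiset.sum_cons]
  abel

/-- Simulation of an expression at a point of a structure `(T, g)`: formulas are interpreted by
`f`, brackets by passing to a `g`-successor. -/
def preMaps (f : Formula P → T → Prop) (g : T → T → Prop) : PreSequent P → T → Prop
  | .empty, _ => True
  | .single A, x => f A x
  | .union Γ Δ, x => preMaps f g Γ x ∧ preMaps f g Δ x
  | .bracket Γ, x => ∃ y, g x y ∧ preMaps f g Γ y

theorem preMaps_congr (f : Formula P → T → Prop) (g : T → T → Prop) {Γ Δ : PreSequent P}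
    (h : PreSequent.Same Γ Δ) : preMaps f g Γ = preMaps f g Δ := by
  induction h with
  | refl => rfl
  | symm _ h => exact h.symm
  | trans _ _ h h' => exact h.trans h'
  | union _ _ h h' => funext x; simp [preMaps, h, h']
  | bracket _ h => funext x; simp [preMaps, h]
  | empty_union => funext x; simp [preMaps]
  | comm => funext x; simp [preMaps, and_comm]
  | assoc => funext x; simp [preMaps, and_assoc]

/-- Simulation of a sequent at a point of a structure `(T, g)`: formulas are interpreted by `f`,
brackets by passing to a `g`-successor. -/
def Maps (f : Formula P → T → Prop) (g : T → T → Prop) : Sequent P → T → Prop :=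
  Quotient.lift (preMaps f g) fun _ _ h => preMaps_congr f g h

section Maps

variable {f : Formula P → T → Prop} {g : T → T → Prop} {x : T}

@[simp] theorem maps_zero : Maps f g 0 x := trivial

@[simp] theorem maps_single {A : Formula P} : Maps f g (single A) x ↔ f A x := Iff.rfl

@[simp] theorem maps_add {Γ Δ : Sequent P} :
    Maps f g (Γ + Δ) x ↔ Maps f g Γ x ∧ Maps f g Δ x := by
  obtain ⟨t⟩ := Γ; obtain ⟨t'⟩ := Δ; exact Iff.rfl

@[simp] theorem maps_bracket {Γ : Sequent P} :
    Maps f g (bracket Γ) x ↔ ∃ y, g x y ∧ Maps f g Γ y := by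
  obtain ⟨t⟩ := Γ; exact Iff.rfl

theorem maps_iff {Γ : Sequent P} : Maps f g Γ x ↔
    (∀ A ∈ Γ.formulas, f A x) ∧ ∀ Λ ∈ Γ.children, ∃ y, g x y ∧ Maps f g Λ y := by
  induction Γ using Sequent.induction with
  | zero => simp
  | single A => simp
  | add Γ Δ h h' =>
    simp only [maps_add, h, h', formulas_add, children_add, Multiset.mem_add, or_imp, forall_and]
    tauto
  | bracket Γ => simp

/-- Simulations compose. -/
theorem Maps.comp {f₀ : Formula P → Sequent P → Prop}
    (hf : ∀ A Δ y, f₀ A Δ → Maps f g Δ y → f A y) {Γ Δ : Sequent P} {x : T}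
    (h : Maps f₀ (fun Δ Λ => Λ ∈ Δ.children) Γ Δ) (h' : Maps f g Δ x) : Maps f g Γ x := by
  induction Γ using Sequent.induction generalizing Δ x with
  | zero => simp
  | single A => exact hf A Δ x h h'
  | add Γ Γ' ih ih' => simp only [maps_add] at h ⊢; exact ⟨ih h.1 h', ih' h.2 h'⟩
  | bracket Γ ih =>
    obtain ⟨Λ, hΛ, hΓ⟩ := maps_bracket.1 h
    obtain ⟨y, hy, hΛy⟩ := (maps_iff.1 h').2 Λ hΛ
    exact maps_bracket.2 ⟨y, hy, ih hΓ hΛy⟩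

end Maps

/-- `Emb Γ Δ`: the tree of `Γ` maps to the tree of `Δ`, with inclusion of the labels. -/
def Emb : Sequent P → Sequent P → Prop :=
  Maps (fun A Δ => A ∈ Δ.formulas) fun Δ Λ => Λ ∈ Δ.children

/-- A formula is realized in the root of a sequent if it occurs there or if its decomposition by
the rules `∧, ∨, □` does. -/
def Realized : Formula P → Sequent P → Prop
  | .pos p, Γ => .pos p ∈ Γ.formulas
  | .neg p, Γ => .neg p ∈ Γ.formulas
  | .or A B, Γ => A.or B ∈ Γ.formulas ∨ Realized A Γ ∧ Realized B Γ
  | .and A B, Γ => A.and B ∈ Γ.formulas ∨ Realized A Γ ∨ Realized B Γ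
  | .dia A, Γ => A.dia ∈ Γ.formulas
  | .box A, Γ => A.box ∈ Γ.formulas ∨ ∃ Λ ∈ Γ.children, Realized A Λ

/-- `Hom Γ Δ`: the tree of `Γ` maps to the tree of `Δ` such that formulas are realized. -/
def Hom : Sequent P → Sequent P → Prop :=
  Maps Realized fun Δ Λ => Λ ∈ Δ.children

theorem Realized.of_mem {A : Formula P} {Γ : Sequent P} (h : A ∈ Γ.formulas) : Realized A Γ := by
  cases A <;> simp [Realized, h]

/-- This makes `Hom` transitive. A formula that is present is realized in the image by the
definition of a map, and a decomposition is followed by induction, through the image of the child in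
the case of a box. A diamond must be present itself, since the diamond rules keep their main
formula. -/
theorem Realized.hom {A : Formula P} {Γ Δ : Sequent P} (hA : Realized A Γ) (h : Hom Γ Δ) :
    Realized A Δ := by
  have key := (maps_iff.1 h).1
  induction A generalizing Γ Δ with
  | pos p => exact key _ hA
  | neg p => exact key _ hA
  | dia A => exact key _ hA
  | or A B ihA ihB =>
    rcases hA with hA | hA
    · exact key _ hA
    · exact .inr ⟨ihA hA.1 h key, ihB hA.2 h key⟩
  | and A B ihA ihB =>
    rcases hA with hA | hA | hA
    · exact key _ hA
    · exact .inr (.inl (ihA hA h key))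
    · exact .inr (.inr (ihB hA h key))
  | box A ih =>
    rcases hA with hA | ⟨Λ, hΛ, hA⟩
    · exact key _ hA
    · obtain ⟨Λ', hΛ', hh⟩ := (maps_iff.1 h).2 Λ hΛ
      exact .inr ⟨Λ', hΛ', ih hA hh (maps_iff.1 hh).1⟩

theorem Hom.trans {Γ Δ Λ : Sequent P} (h : Hom Γ Δ) (h' : Hom Δ Λ) : Hom Γ Λ :=
  Maps.comp (fun _ _ _ hA h => hA.hom h) h h'

theorem Maps.of_emb {f : Formula P → T → Prop} {g : T → T → Prop} {x : T} {Γ Δ : Sequent P}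
    (h : Emb Γ Δ) (h' : Maps f g Δ x) : Maps f g Γ x :=
  Maps.comp (fun A _ _ hA h => (maps_iff.1 h).1 A hA) h h'

theorem Emb.trans {Γ Δ Λ : Sequent P} (h : Emb Γ Δ) (h' : Emb Δ Λ) : Emb Γ Λ := h'.of_emb h

theorem Emb.refl (Γ : Sequent P) : Emb Γ Γ := by
  suffices h : ∀ n (Γ : Sequent P), Γ.weight < n → Emb Γ Γ from h _ Γ (Nat.lt_succ_self _)
  intro n
  induction n with
  | zero => simp
  | succ n ih =>
    exact fun Γ hΓ => maps_iff.2 ⟨fun _ => id, fun Λ hΛ =>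
      ⟨Λ, hΛ, ih Λ (by have := weight_lt_of_mem_children hΛ; omega)⟩⟩

theorem Emb.hom {Γ Δ : Sequent P} (h : Emb Γ Δ) : Hom Γ Δ := by
  induction Γ using Sequent.induction generalizing Δ with
  | zero => exact maps_zero
  | single A => exact Realized.of_mem h
  | add Γ Γ' ih ih' => exact maps_add.2 ⟨ih (maps_add.1 h).1, ih' (maps_add.1 h).2⟩
  | bracket Γ ih =>
    obtain ⟨Λ, hΛ, h⟩ := maps_bracket.1 h
    exact maps_bracket.2 ⟨Λ, hΛ, ih h⟩

theorem Emb.add_right (Γ Δ : Sequent P) : Emb Γ (Γ + Δ) :=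
  (maps_add.1 (Emb.refl (Γ + Δ))).1

theorem Emb.add_left (Γ Δ : Sequent P) : Emb Δ (Γ + Δ) :=
  (maps_add.1 (Emb.refl (Γ + Δ))).2

theorem Hom.refl (Γ : Sequent P) : Hom Γ Γ := (Emb.refl Γ).hom

theorem Hom.add_right (Γ Δ : Sequent P) : Hom Γ (Γ + Δ) := (Emb.add_right Γ Δ).hom

theorem Hom.add_left (Γ Δ : Sequent P) : Hom Δ (Γ + Δ) := (Emb.add_left Γ Δ).hom

theorem Emb.add_bracket {Γ Δ Δ' : Sequent P} (h : Emb Δ Δ') :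
    Emb (Γ + bracket Δ) (Γ + bracket Δ') :=
  maps_add.2 ⟨Emb.add_right _ _, maps_bracket.2 ⟨Δ', by simp, h⟩⟩

theorem Hom.add_bracket {Γ Δ Δ' : Sequent P} (h : Hom Δ Δ') :
    Hom (Γ + bracket Δ) (Γ + bracket Δ') :=
  maps_add.2 ⟨Hom.add_right _ _, maps_bracket.2 ⟨Δ', by simp, h⟩⟩

/-- `plug [Γ₁, …, Γₙ] Δ` is `Γ₁, [Γ₂, [… [Γₙ, [Δ]]]]`: the sequent with the subtree `Δ` at depth
`n` and the given sequents beside the path to it. -/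
def plug : List (Sequent P) → Sequent P → Sequent P
  | [], Δ => Δ
  | Γ :: l, Δ => Γ + bracket (plug l Δ)

theorem plug_append_singleton (l : List (Sequent P)) (Γ Δ : Sequent P) :
    plug (l ++ [Γ]) Δ = plug l (Γ + bracket Δ) := by
  induction l with
  | nil => rfl
  | cons _ l ih => simp [plug, ih]

theorem SubtreeOf.plug (l : List (Sequent P)) (Δ : Sequent P) : SubtreeOf Δ (plug l Δ) := by
  induction l with
  | nil => exact .refl _
  | cons Γ l ih => exact .child (by simp [Sequent.plug]) ih

theorem SubtreeOf.exists_plug {Δ Γ : Sequent P} (h : SubtreeOf Δ Γ) : ∃ l, Γ = Sequent.plug l Δ := by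
  induction h with
  | refl => exact ⟨[], rfl⟩
  | child h _ ih =>
    obtain ⟨l, rfl⟩ := ih
    obtain ⟨Z, rfl⟩ := exists_eq_add_bracket h
    exact ⟨Z :: l, rfl⟩

theorem Emb.plug {l : List (Sequent P)} {Δ Δ' : Sequent P} (h : Emb Δ Δ') :
    Emb (plug l Δ) (plug l Δ') := by
  induction l with
  | nil => exact h
  | cons Γ l ih => exact ih.add_bracket

theorem Hom.plug {l : List (Sequent P)} {Δ Δ' : Sequent P} (h : Hom Δ Δ') :
    Hom (plug l Δ) (plug l Δ') := by
  induction l with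
  | nil => exact h
  | cons Γ l ih => exact ih.add_bracket

/-- A homomorphism maps the subtree at a node to the subtree at a node of the same depth, where it
can be modified. -/
theorem Hom.exists_plug {l : List (Sequent P)} {X Γ' : Sequent P} (h : Hom (Sequent.plug l X) Γ') :
    ∃ l' Δ', l'.length = l.length ∧ Γ' = Sequent.plug l' Δ' ∧ Hom X Δ' ∧
      ∀ Y Δ'', Hom Δ' Δ'' → Hom Y Δ'' → Hom (Sequent.plug l Y) (Sequent.plug l' Δ'') := by
  induction l generalizing Γ' with
  | nil => exact ⟨[], Γ', rfl, rfl, h, fun _ _ _ h => h⟩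
  | cons Γ l ih =>
    obtain ⟨h₁, h₂⟩ := maps_add.1 h
    obtain ⟨Λ', hΛ', h₃⟩ := maps_bracket.1 h₂
    obtain ⟨Z, rfl⟩ := exists_eq_add_bracket hΛ'
    obtain ⟨l', Δ', hl, rfl, hX, hY⟩ := ih h₃
    refine ⟨Z :: l', Δ', by simp [hl], rfl, hX, fun Y Δ'' hΔ hYΔ => ?_⟩
    exact maps_add.2 ⟨Hom.trans h₁ (hΔ.plug.add_bracket),
      maps_bracket.2 ⟨Sequent.plug l' Δ'', by simp [Sequent.plug], hY Y Δ'' hΔ hYΔ⟩⟩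

end Sequent

/-! ### Contexts as paths from the root -/

namespace Ctx

variable {P : Type u}

open Sequent (plug)

/-- The context with the hole at the end of a path, beside a given sequent. -/
def ofPath (Z : Sequent P) : List (Sequent P) → Ctx P
  | [] => .add Z .hole
  | Γ :: l => .add Γ (.bracket (ofPath Z l))

@[simp] theorem ofPath_fill (Z : Sequent P) (l : List (Sequent P)) (Y : Sequent P) :
    (ofPath Z l).fill Y = plug l (Z + Y) := by
  induction l with
  | nil => rfl
  | cons Γ l ih => simp [ofPath, fill, plug, ih]

@[simp] theorem ofPath_depth (Z : Sequent P) (l : List (Sequent P)) :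
    (ofPath Z l).depth = l.length := by
  induction l with
  | nil => rfl
  | cons Γ l ih => simp [ofPath, depth, ih]

@[simp] theorem ofPath_beside (Z : Sequent P) (l : List (Sequent P)) :
    (ofPath Z l).beside = Z := by
  induction l with
  | nil => simp [ofPath, beside, depth]
  | cons Γ l ih => simp [ofPath, beside, depth, ih]

/-- Normal form of a context: summands next to the same node of the path are merged. Rules stated
with contexts become rules at the end of a path, which maps of trees can follow. -/
theorem exists_plug (C : Ctx P) :
    ∃ l, l.length = C.depth ∧ ∀ Y, C.fill Y = plug l (C.beside + Y) := by
  induction C with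
  | hole => exact ⟨[], rfl, fun Y => by simp [fill, beside, plug]⟩
  | add Γ C ih =>
    obtain ⟨l, hl, h⟩ := ih
    cases l with
    | nil =>
      have hC : C.depth = 0 := hl.symm
      exact ⟨[], hl, fun Y => by simp [fill, beside, hC, h, plug, add_assoc]⟩
    | cons Z l =>
      have hC : C.depth ≠ 0 := by simp [← hl]
      exact ⟨(Γ + Z) :: l, hl, fun Y => by simp [fill, beside, hC, h, plug, add_assoc]⟩
  | bracket C ih =>
    obtain ⟨l, hl, h⟩ := ih
    exact ⟨0 :: l, by simp [depth, hl], fun Y => by simp [fill, beside, h, plug]⟩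

end Ctx

/-- Two holes: the first one in a node at depth `l.length` that contains `B`, the second one in a
node that does not contain `B`. -/
theorem Ctx₂.exists_fill {P : Type u} {B : Formula P} {l l' : List (Sequent P)} {Z Δ : Sequent P}
    (h : Sequent.plug l (Z + single B) = Sequent.plug l' Δ) (hB : B ∉ Δ.formulas) :
    ∃ C : Ctx₂ P, C.fill (single B) 0 = Sequent.plug l' Δ ∧
      C.fill (single B) (single B) = Sequent.plug l' (Δ + single B) ∧
      (C.fillSnd 0).depth = l.length ∧ (C.fillFst (single B)).beside = Δ := by
  induction l' generalizing l with
  | nil =>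
    cases l with
    | nil =>
      simp only [Sequent.plug] at h
      simp [← h] at hB
    | cons G l =>
      refine ⟨.add G (.fork (.bracket (.ofPath Z l)) .hole), ?_⟩
      simp only [Sequent.plug] at h
      simp [fill, fillFst, fillSnd, Ctx.fill, Ctx.depth, Ctx.beside, Sequent.plug, ← h, add_assoc]
  | cons H l' ih =>
    cases l with
    | nil =>
      have hH : B ∈ H.formulas := by
        have := congrArg Sequent.formulas h
        simp only [Sequent.plug, Sequent.formulas_add, Sequent.formulas_single,
          Sequent.formulas_bracket, add_zero] at this
        simp [← this]
      obtain ⟨H, rfl⟩ := Sequent.exists_eq_add_single hH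
      refine ⟨.add H (.fork .hole (.bracket (.ofPath Δ l'))), ?_⟩
      simp [fill, fillFst, fillSnd, Ctx.fill, Ctx.depth, Ctx.beside, Sequent.plug, add_assoc]
    | cons G l =>
      -- Only the sequent is given, not the positions in it. If the two paths enter equal child
      -- subtrees, both holes are placed in one and the same child; otherwise the child with the
      -- first hole is one of those in `H`, and the context forks here.
      by_cases hVU : Sequent.plug l (Z + single B) = Sequent.plug l' Δ
      · obtain ⟨C, h₁, h₂, h₃, h₄⟩ := ih hVU
        refine ⟨.add H (.bracket C), ?_⟩
        simp only [fill] at h₁ h₂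
        simp [fill, fillFst, fillSnd, Ctx.fill, Ctx.depth, Ctx.beside, Sequent.plug, h₁, h₂, h₃, h₄]
      · have hH : Sequent.plug l (Z + single B) ∈ H.children := by
          have := congrArg Sequent.children h
          simp only [Sequent.plug, Sequent.children_add, Sequent.children_bracket] at this
          have hm : Sequent.plug l (Z + single B) ∈ H.children + {Sequent.plug l' Δ} := by
            simp [← this]
          simpa [hVU] using hm
        obtain ⟨H, rfl⟩ := Sequent.exists_eq_add_bracket hH
        refine ⟨.add H (.fork (.bracket (.ofPath Z l)) (.bracket (.ofPath Δ l'))), ?_⟩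
        simp [fill, fillFst, fillSnd, Ctx.fill, Ctx.depth, Ctx.beside, Sequent.plug, add_assoc]

/-! ### Structural rules -/

section Provable

open Sequent (plug Hom Emb Realized maps_add maps_single maps_bracket maps_iff)

variable {P : Type u} {X : Set ModalAxiom}

theorem modal_mem_system {ρ : ModalAxiom} : RuleName.modal ρ ∈ system X ↔ ρ ∈ X := by
  simp [system]

namespace Provable

variable {l : List (Sequent P)} {Z Λ : Sequent P} {A B : Formula P}

theorem and_plug (hA : Provable X (plug l (Z + single A)))
    (hB : Provable X (plug l (Z + single B))) : Provable X (plug l (Z + single (A.and B))) := by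
  simpa using Provable.rule (by simp [system]) (Instance.and (Ctx.ofPath Z l) A B)
    (by simpa using ⟨hA, hB⟩)

theorem or_plug (h : Provable X (plug l (Z + (single A + single B)))) :
    Provable X (plug l (Z + single (A.or B))) := by
  simpa using Provable.rule (by simp [system]) (Instance.or (Ctx.ofPath Z l) A B) (by simpa using h)

theorem box_plug (h : Provable X (plug l (Z + bracket (single A)))) :
    Provable X (plug l (Z + single A.box)) := by
  simpa using Provable.rule (by simp [system]) (Instance.box (Ctx.ofPath Z l) A) (by simpa using h)

theorem k_plug (h : Provable X (plug l (Z + (single A.dia + bracket (Λ + single A))))) :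
    Provable X (plug l (Z + (single A.dia + bracket Λ))) := by
  simpa using Provable.rule (by simp [system]) (Instance.k (Ctx.ofPath Z l) A Λ) (by simpa using h)

theorem d_plug (hX : .d ∈ X) (h : Provable X (plug l (Z + (single A.dia + bracket (single A))))) :
    Provable X (plug l (Z + single A.dia)) := by
  simpa using Provable.rule (modal_mem_system.2 hX) (Instance.d (Ctx.ofPath Z l) A)
    (by simpa using h)

theorem t_plug (hX : .t ∈ X) (h : Provable X (plug l (Z + (single A.dia + single A)))) :
    Provable X (plug l (Z + single A.dia)) := by
  simpa using Provable.rule (modal_mem_system.2 hX) (Instance.t (Ctx.ofPath Z l) A)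
    (by simpa using h)

theorem b_plug (hX : .b ∈ X)
    (h : Provable X (plug l (Z + (bracket (Λ + single A.dia) + single A)))) :
    Provable X (plug l (Z + bracket (Λ + single A.dia))) := by
  simpa using Provable.rule (modal_mem_system.2 hX) (Instance.b (Ctx.ofPath Z l) A Λ)
    (by simpa using h)

theorem four_plug (hX : .four ∈ X)
    (h : Provable X (plug l (Z + (single A.dia + bracket (Λ + single A.dia))))) :
    Provable X (plug l (Z + (single A.dia + bracket Λ))) := by
  simpa using Provable.rule (modal_mem_system.2 hX) (Instance.four (Ctx.ofPath Z l) A Λ)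
    (by simpa using h)

theorem five_plug (hX : .five ∈ X) {l' : List (Sequent P)} {Δ : Sequent P}
    (hl : 0 < l.length) (hΔ : plug l (Z + single A.dia) = plug l' Δ) (hA : A.dia ∉ Δ.formulas)
    (h : Provable X (plug l' (Δ + single A.dia))) : Provable X (plug l' Δ) := by
  obtain ⟨C, h₁, h₂, h₃, -⟩ := Ctx₂.exists_fill hΔ hA
  have := Provable.rule (modal_mem_system.2 hX) (Instance.five C A (by omega))
    (by simpa [h₂] using h)
  rwa [h₁] at this

/-- Weakening, contraction and the inverse rules, all at once. -/
theorem of_hom {Γ Γ' : Sequent P} (h : Provable X Γ) (hΓ : Hom Γ Γ') : Provable X Γ' := by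
  induction h generalizing Γ' with
  | ax h =>
    obtain ⟨C, p, rfl⟩ := h
    obtain ⟨l, -, hC⟩ := C.exists_plug
    rw [hC] at hΓ
    obtain ⟨l', Δ, -, rfl, hΔ, -⟩ := hΓ.exists_plug
    have hp : Formula.pos p ∈ Δ.formulas := (maps_iff.1 hΔ).1 (.pos p) (by simp)
    have hn : Formula.neg p ∈ Δ.formulas := (maps_iff.1 hΔ).1 (.neg p) (by simp)
    obtain ⟨Δ, rfl⟩ := Sequent.exists_eq_add_single hp
    have hn : Formula.neg p ∈ Δ.formulas := by simpa using hn
    obtain ⟨Δ, rfl⟩ := Sequent.exists_eq_add_single hn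
    refine .ax ⟨.ofPath Δ l', p, ?_⟩
    simp only [Ctx.ofPath_fill]
    congr 1
    abel
  | rule hρ hi _ ih =>
    cases hi with
    | and C A B =>
      simp only [List.mem_cons, List.not_mem_nil, or_false, forall_eq_or_imp, forall_eq] at ih
      obtain ⟨ihA, ihB⟩ := ih
      obtain ⟨l, -, hC⟩ := C.exists_plug
      simp only [hC] at hΓ ihA ihB
      obtain ⟨l', Δ, -, rfl, hΔ, hY⟩ := hΓ.exists_plug
      obtain ⟨hZ, hM⟩ := maps_add.1 hΔ
      -- If the conjunction is present in the image node, the rule is applied there. If it is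
      -- realized through a conjunct, one premise already maps to the target. The rules for
      -- disjunction and box are treated likewise.
      rcases hM with hM | hM | hM
      · obtain ⟨Δ, rfl⟩ := Sequent.exists_eq_add_single hM
        have key : ∀ D, Realized (A.and B) (Δ + single D) → Realized D (Δ + single D) →
            Hom (plug l (C.beside + single D)) (plug l' (Δ + single D)) := by
          intro D hD hD'
          have : Hom (Δ + single (A.and B)) (Δ + single D) :=
            maps_add.2 ⟨Hom.add_right _ _, hD⟩
          exact hY _ _ this (maps_add.2 ⟨Hom.trans hZ this, hD'⟩)
        have hA : Realized A (Δ + single A) := .of_mem (by simp)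
        have hB : Realized B (Δ + single B) := .of_mem (by simp)
        exact and_plug (ihA (key A (.inr (.inl hA)) hA)) (ihB (key B (.inr (.inr hB)) hB))
      · exact ihA (hY _ _ (Hom.refl _) (maps_add.2 ⟨hZ, hM⟩))
      · exact ihB (hY _ _ (Hom.refl _) (maps_add.2 ⟨hZ, hM⟩))
    | or C A B =>
      simp only [List.mem_cons, List.not_mem_nil, or_false, forall_eq] at ih
      obtain ⟨l, -, hC⟩ := C.exists_plug
      simp only [hC] at hΓ ih
      obtain ⟨l', Δ, -, rfl, hΔ, hY⟩ := hΓ.exists_plug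
      obtain ⟨hZ, hM⟩ := maps_add.1 hΔ
      rcases hM with hM | hM
      · obtain ⟨Δ, rfl⟩ := Sequent.exists_eq_add_single hM
        have hA : Realized A (Δ + (single A + single B)) := .of_mem (by simp)
        have hB : Realized B (Δ + (single A + single B)) := .of_mem (by simp)
        have : Hom (Δ + single (A.or B)) (Δ + (single A + single B)) :=
          maps_add.2 ⟨Hom.add_right _ _, .inr ⟨hA, hB⟩⟩
        exact or_plug (ih (hY _ _ this (maps_add.2 ⟨Hom.trans hZ this, maps_add.2 ⟨hA, hB⟩⟩)))
      · exact ih (hY _ _ (Hom.refl _) (maps_add.2 ⟨hZ, maps_add.2 hM⟩))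
    | box C A =>
      simp only [List.mem_cons, List.not_mem_nil, or_false, forall_eq] at ih
      obtain ⟨l, -, hC⟩ := C.exists_plug
      simp only [hC] at hΓ ih
      obtain ⟨l', Δ, -, rfl, hΔ, hY⟩ := hΓ.exists_plug
      obtain ⟨hZ, hM⟩ := maps_add.1 hΔ
      rcases hM with hM | hM
      · obtain ⟨Δ, rfl⟩ := Sequent.exists_eq_add_single hM
        have hA : Hom (bracket (single A)) (Δ + bracket (single A)) := Hom.add_left _ _
        have : Hom (Δ + single A.box) (Δ + bracket (single A)) :=
          maps_add.2 ⟨Hom.add_right _ _, .inr (maps_bracket.1 hA)⟩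
        exact box_plug (ih (hY _ _ this (maps_add.2 ⟨Hom.trans hZ this, hA⟩)))
      · exact ih (hY _ _ (Hom.refl _) (maps_add.2 ⟨hZ, maps_bracket.2 hM⟩))
    | k C A Λ =>
      simp only [List.mem_cons, List.not_mem_nil, or_false, forall_eq] at ih
      obtain ⟨l, -, hC⟩ := C.exists_plug
      simp only [hC] at hΓ ih
      obtain ⟨l', Δ, -, rfl, hΔ, hY⟩ := hΓ.exists_plug
      obtain ⟨hZ, hM⟩ := maps_add.1 hΔ
      obtain ⟨hA, hM⟩ := maps_add.1 hM
      obtain ⟨Λ', hΛ', hΛ⟩ := maps_bracket.1 hM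
      obtain ⟨Δ, rfl⟩ := Sequent.exists_eq_add_bracket hΛ'
      have hA : A.dia ∈ Δ.formulas := by simpa [Realized] using hA
      obtain ⟨Δ, rfl⟩ := Sequent.exists_eq_add_single hA
      rw [add_assoc] at *
      have : Hom (Δ + (single A.dia + bracket Λ')) (Δ + (single A.dia + bracket (Λ' + single A))) := by
        simp only [← add_assoc]
        exact (Hom.add_right _ _).add_bracket
      refine k_plug (ih (hY _ _ this (maps_add.2 ⟨Hom.trans hZ this, maps_add.2
        ⟨.of_mem (by simp), maps_bracket.2 ⟨Λ' + single A, by simp, maps_add.2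
          ⟨Hom.trans hΛ (Hom.add_right _ _), .of_mem (by simp)⟩⟩⟩⟩)))
    | d C A =>
      simp only [List.mem_cons, List.not_mem_nil, or_false, forall_eq] at ih
      obtain ⟨l, -, hC⟩ := C.exists_plug
      simp only [hC] at hΓ ih
      obtain ⟨l', Δ, -, rfl, hΔ, hY⟩ := hΓ.exists_plug
      obtain ⟨hZ, hM⟩ := maps_add.1 hΔ
      obtain ⟨Δ, rfl⟩ := Sequent.exists_eq_add_single hM
      have : Hom (Δ + single A.dia) (Δ + (single A.dia + bracket (single A))) := by
        simp only [← add_assoc]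
        exact Hom.add_right _ _
      exact d_plug (modal_mem_system.1 hρ) (ih (hY _ _ this (maps_add.2 ⟨Hom.trans hZ this,
        Hom.add_left _ _⟩)))
    | t C A =>
      simp only [List.mem_cons, List.not_mem_nil, or_false, forall_eq] at ih
      obtain ⟨l, -, hC⟩ := C.exists_plug
      simp only [hC] at hΓ ih
      obtain ⟨l', Δ, -, rfl, hΔ, hY⟩ := hΓ.exists_plug
      obtain ⟨hZ, hM⟩ := maps_add.1 hΔ
      obtain ⟨Δ, rfl⟩ := Sequent.exists_eq_add_single hM
      have : Hom (Δ + single A.dia) (Δ + (single A.dia + single A)) := by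
        simp only [← add_assoc]
        exact Hom.add_right _ _
      exact t_plug (modal_mem_system.1 hρ) (ih (hY _ _ this (maps_add.2 ⟨Hom.trans hZ this,
        Hom.add_left _ _⟩)))
    | b C A Λ =>
      simp only [List.mem_cons, List.not_mem_nil, or_false, forall_eq] at ih
      obtain ⟨l, -, hC⟩ := C.exists_plug
      simp only [hC] at hΓ ih
      obtain ⟨l', Δ, -, rfl, hΔ, hY⟩ := hΓ.exists_plug
      obtain ⟨hZ, hM⟩ := maps_add.1 hΔ
      obtain ⟨Λ', hΛ', hΛ⟩ := maps_bracket.1 hM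
      obtain ⟨Δ, rfl⟩ := Sequent.exists_eq_add_bracket hΛ'
      obtain ⟨-, hA⟩ := maps_add.1 hΛ
      obtain ⟨Λ', rfl⟩ := Sequent.exists_eq_add_single hA
      have : Hom (Δ + bracket (Λ' + single A.dia))
          (Δ + (bracket (Λ' + single A.dia) + single A)) := by
        simp only [← add_assoc]
        exact Hom.add_right _ _
      exact b_plug (modal_mem_system.1 hρ) (ih (hY _ _ this (maps_add.2 ⟨Hom.trans hZ this,
        maps_add.2 ⟨Hom.trans hM this, .of_mem (by simp)⟩⟩)))
    | four C A Λ =>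
      simp only [List.mem_cons, List.not_mem_nil, or_false, forall_eq] at ih
      obtain ⟨l, -, hC⟩ := C.exists_plug
      simp only [hC] at hΓ ih
      obtain ⟨l', Δ, -, rfl, hΔ, hY⟩ := hΓ.exists_plug
      obtain ⟨hZ, hM⟩ := maps_add.1 hΔ
      obtain ⟨hA, hM⟩ := maps_add.1 hM
      obtain ⟨Λ', hΛ', hΛ⟩ := maps_bracket.1 hM
      obtain ⟨Δ, rfl⟩ := Sequent.exists_eq_add_bracket hΛ'
      have hA : A.dia ∈ Δ.formulas := by simpa [Realized] using hA
      obtain ⟨Δ, rfl⟩ := Sequent.exists_eq_add_single hA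
      rw [add_assoc] at *
      have : Hom (Δ + (single A.dia + bracket Λ'))
          (Δ + (single A.dia + bracket (Λ' + single A.dia))) := by
        simp only [← add_assoc]
        exact (Hom.add_right _ _).add_bracket
      refine four_plug (modal_mem_system.1 hρ) (ih (hY _ _ this (maps_add.2 ⟨Hom.trans hZ this,
        maps_add.2 ⟨.of_mem (by simp), maps_bracket.2 ⟨Λ' + single A.dia, by simp, maps_add.2
          ⟨Hom.trans hΛ (Hom.add_right _ _), .of_mem (by simp)⟩⟩⟩⟩)))
    | five C A hC =>
      simp only [List.mem_cons, List.not_mem_nil, or_false, forall_eq] at ih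
      -- The map is followed twice: along the path to the first hole, to find the diamond in the
      -- target at the same positive depth, and along the path to the second hole, to find where it
      -- is to be added.
      obtain ⟨l₁, hl₁, hC₁⟩ := (C.fillSnd 0).exists_plug
      have hΓ₁ := hΓ
      rw [Ctx₂.fill_eq, hC₁] at hΓ₁
      obtain ⟨l₁', Δ₁, hl₁', hΓ', hΔ₁, -⟩ := hΓ₁.exists_plug
      obtain ⟨Z₁, rfl⟩ := Sequent.exists_eq_add_single (maps_add.1 hΔ₁).2
      obtain ⟨l, -, hC⟩ := (C.fillFst (single A.dia)).exists_plug
      simp only [Ctx₂.fill, hC] at hΓ ih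
      obtain ⟨l', Δ, -, rfl, hΔ, hY⟩ := hΓ.exists_plug
      -- The images of the two holes may coincide, or the second may contain the diamond anyway;
      -- then the premise maps to the target as it stands.
      by_cases hA : A.dia ∈ Δ.formulas
      · exact ih (hY _ _ (Hom.refl _) (maps_add.2 ⟨(maps_add.1 hΔ).1, hA⟩))
      · have : Hom Δ (Δ + single A.dia) := Hom.add_right _ _
        exact five_plug (modal_mem_system.1 hρ) (by omega) hΓ'.symm hA (ih (hY _ _ this
          (maps_add.2 ⟨Hom.trans (maps_add.1 hΔ).1 this, Hom.add_left _ _⟩)))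

end Provable

/-- The rules `ρ°` are sound for provability. -/
theorem InstanceO.provable {ρ : RuleName} (hρ : ρ ∈ system X) {Γ : Sequent P}
    {Γs : List (Sequent P)} (hi : InstanceO ρ Γ Γs) (h : ∀ Δ ∈ Γs, Provable X Δ) :
    Provable X Γ := by
  cases hi with
  | and C A B =>
    simp only [List.mem_cons, List.not_mem_nil, or_false, forall_eq_or_imp, forall_eq] at h
    obtain ⟨l, -, hC⟩ := C.exists_plug
    simp only [hC] at h ⊢
    -- The premise of `∧°` maps to the premise of `∧`: the main formula that it keeps is realized by
    -- the conjunct. The same works for `∨°` and `□°`.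
    refine .and_plug (h.1.of_hom (Hom.plug ?_)) (h.2.of_hom (Hom.plug ?_))
    · have hA : Realized A (C.beside + single A) := .of_mem (by simp)
      exact maps_add.2 ⟨Hom.add_right _ _, maps_add.2 ⟨.inr (.inl hA), hA⟩⟩
    · have hB : Realized B (C.beside + single B) := .of_mem (by simp)
      exact maps_add.2 ⟨Hom.add_right _ _, maps_add.2 ⟨.inr (.inr hB), hB⟩⟩
  | or C A B =>
    simp only [List.mem_cons, List.not_mem_nil, or_false, forall_eq] at h
    obtain ⟨l, -, hC⟩ := C.exists_plug
    simp only [hC] at h ⊢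
    refine .or_plug (h.of_hom (Hom.plug ?_))
    have hA : Realized A (C.beside + (single A + single B)) := .of_mem (by simp)
    have hB : Realized B (C.beside + (single A + single B)) := .of_mem (by simp)
    exact maps_add.2 ⟨Hom.add_right _ _, maps_add.2 ⟨maps_add.2 ⟨.inr ⟨hA, hB⟩, hA⟩, hB⟩⟩
  | box C A =>
    simp only [List.mem_cons, List.not_mem_nil, or_false, forall_eq] at h
    obtain ⟨l, -, hC⟩ := C.exists_plug
    simp only [hC] at h ⊢
    refine .box_plug (h.of_hom (Hom.plug ?_))
    have hA : Hom (bracket (single A)) (C.beside + bracket (single A)) := Hom.add_left _ _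
    exact maps_add.2 ⟨Hom.add_right _ _, maps_add.2 ⟨.inr (maps_bracket.1 hA), hA⟩⟩
  | k C A Δ => exact .rule hρ (.k C A Δ) h
  | d C A => exact .rule hρ (.d C A) h
  | t C A => exact .rule hρ (.t C A) h
  | b C A Δ => exact .rule hρ (.b C A Δ) h
  | four C A Δ => exact .rule hρ (.four C A Δ) h
  | five C A hC => exact .rule hρ (.five C A hC) h

end Provable

/-! ### Countermodels -/

namespace Formula

variable {P : Type u} {S : Type v} {R : S → S → Prop} {V : P → Set S}

theorem not_holds_bot [Nonempty P] (s : S) : ¬ Holds R V s bot := fun h => h.2 h.1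

theorem holds_disj [Nonempty P] (s : S) (l : List (Formula P)) :
    Holds R V s (disj l) ↔ ∃ A ∈ l, Holds R V s A := by
  cases l with
  | nil => simp [disj, not_holds_bot]
  | cons A l =>
    simp only [disj]
    induction l generalizing A with
    | nil => simp
    | cons B l ih => simp [ih, Holds, or_assoc]

end Formula

namespace Sequent

variable {P : Type u} {S : Type v} {R : S → S → Prop} {V : P → Set S}

/-- A sequent is falsified at a state if its formulas are false there and each of its boxed
sequents is falsified at some successor. -/
def Falsified (R : S → S → Prop) (V : P → Set S) : Sequent P → S → Prop :=
  Maps (fun A s => ¬ Formula.Holds R V s A) R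

/-- A disjunction fails iff all disjuncts fail, and a box fails iff its body fails at some
successor. The induction is on weight because the corresponding formula recurs on children. -/
theorem holds_toFormula [Nonempty P] (Γ : Sequent P) (s : S) :
    Formula.Holds R V s Γ.toFormula ↔ ¬ Falsified R V Γ s := by
  induction hn : Γ.weight using Nat.strong_induction_on generalizing Γ s with
  | _ n ih =>
    subst hn
    rw [toFormula, Formula.holds_disj, Falsified, maps_iff]
    simp only [List.mem_append, Multiset.mem_toList, List.mem_map, List.mem_attach, true_and,
      Subtype.exists, or_and_right, exists_or, not_and_or, not_forall, not_not, not_exists]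
    refine or_congr (by simp) ⟨?_, ?_⟩
    · rintro ⟨_, ⟨Λ, hΛ, rfl⟩, h⟩
      refine ⟨Λ, hΛ, fun t => not_and_or.1 fun ht =>
        (ih _ (weight_lt_of_mem_children hΛ) Λ t rfl).1 (h t ht.1) ht.2⟩
    · rintro ⟨Λ, hΛ, h⟩
      exact ⟨_, ⟨Λ, hΛ, rfl⟩, fun t ht => (ih _ (weight_lt_of_mem_children hΛ) Λ t rfl).2
        fun hf => not_and_or.2 (h t) ⟨ht, hf⟩⟩

theorem Falsified.not_validInFrame [Nonempty P] {Γ : Sequent P} {s : S}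
    (h : Falsified R V Γ s) : ¬ Γ.ValidInFrame R :=
  fun hv => (holds_toFormula Γ s).1 (hv V s) h

/-- The set of formulas in the root. -/
def label (Γ : Sequent P) : Set (Formula P) := {A | A ∈ Γ.formulas}

/-- The conditions for a node to be saturated within `Γ` with respect to the rules of step 1. -/
structure SaturatedAt (X : Set ModalAxiom) (Γ Δ : Sequent P) : Prop where
  ax : ∀ p, .pos p ∈ Δ.formulas → .neg p ∉ Δ.formulas
  and : ∀ A B, A.and B ∈ Δ.formulas → A ∈ Δ.formulas ∨ B ∈ Δ.formulas
  or : ∀ A B, A.or B ∈ Δ.formulas → A ∈ Δ.formulas ∧ B ∈ Δ.formulas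
  k : ∀ A : Formula P, A.dia ∈ Δ.formulas → ∀ Λ ∈ Δ.children, A ∈ Λ.formulas
  t : .t ∈ X → ∀ A : Formula P, A.dia ∈ Δ.formulas → A ∈ Δ.formulas
  b : .b ∈ X → ∀ A : Formula P, ∀ Λ ∈ Δ.children, A.dia ∈ Λ.formulas → A ∈ Δ.formulas
  four : .four ∈ X → ∀ A : Formula P, A.dia ∈ Δ.formulas → ∀ Λ ∈ Δ.children, A.dia ∈ Λ.formulas
  five : .five ∈ X → ∀ A : Formula P, ∀ G l Λ, Γ = plug (G :: l) Λ → A.dia ∈ Λ.formulas → A.dia ∈ Δ.formulas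

/-- A violated condition on the node is exactly the proviso under which the corresponding `ρ°`
applies there; for the first condition it exhibits an axiom. -/
theorem saturatedAt_of_not_step1 {X : Set ModalAxiom} {Γ : Sequent P} (hax : ¬ Axiomatic Γ)
    (h : ∀ Γs, ¬ InstanceStep1 X Γ Γs) {l : List (Sequent P)} {Δ : Sequent P}
    (hΓ : Γ = plug l Δ) : SaturatedAt X Γ Δ := by
  have step : ∀ {ρ Γ' Γs}, InstanceO ρ Γ' Γs → Γ' = Γ → ρ ∈ system X → ρ ≠ .box →
      ρ ≠ .modal .d → False := by
    rintro ρ _ Γs hi rfl hρ h₁ h₂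
    exact h Γs ⟨ρ, hρ, h₁, h₂, hi⟩
  have step' : ∀ {ρ Γ' Γs}, InstanceO (.modal ρ) Γ' Γs → Γ' = Γ → ρ ∈ X → ρ ≠ .d → False :=
    fun hi e hρ hd => step hi e (modal_mem_system.2 hρ) (by simp) (by simpa using hd)
  constructor
  · intro p hp hn
    obtain ⟨Z, rfl⟩ := exists_eq_add_single hp
    obtain ⟨Z, rfl⟩ := exists_eq_add_single (Γ := Z) (by simpa using hn)
    refine hax ⟨.ofPath Z l, p, ?_⟩
    rw [hΓ, Ctx.ofPath_fill]
    congr 1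
    abel
  · intro A B hAB
    by_contra hc
    rw [not_or] at hc
    obtain ⟨Z, rfl⟩ := exists_eq_add_single hAB
    exact step (.and (.ofPath Z l) A B (by simpa using hc.1) (by simpa using hc.2))
      (by simp [hΓ]) (by simp [system]) (by simp) (by simp)
  · intro A B hAB
    by_contra hc
    rw [not_and_or] at hc
    obtain ⟨Z, rfl⟩ := exists_eq_add_single hAB
    exact step (.or (.ofPath Z l) A B (by simpa using hc))
      (by simp [hΓ]) (by simp [system]) (by simp) (by simp)
  · intro A hA Λ hΛ
    by_contra hc
    obtain ⟨Z, rfl⟩ := exists_eq_add_bracket hΛ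
    obtain ⟨Z, rfl⟩ := exists_eq_add_single (Γ := Z) (by simpa using hA)
    exact step (.k (.ofPath Z l) A Λ hc)
      (by simp [hΓ, add_assoc]) (by simp [system]) (by simp) (by simp)
  · intro hX A hA
    by_contra hc
    obtain ⟨Z, rfl⟩ := exists_eq_add_single hA
    exact step' (.t (.ofPath Z l) A (by simpa using hc)) (by simp [hΓ]) hX (by simp)
  · intro hX A Λ hΛ hA
    by_contra hc
    obtain ⟨Z, rfl⟩ := exists_eq_add_bracket hΛ
    obtain ⟨Λ, rfl⟩ := exists_eq_add_single hA
    exact step' (.b (.ofPath Z l) A Λ (by simpa using hc)) (by simp [hΓ]) hX (by simp)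
  · intro hX A hA Λ hΛ
    by_contra hc
    obtain ⟨Z, rfl⟩ := exists_eq_add_bracket hΛ
    obtain ⟨Z, rfl⟩ := exists_eq_add_single (Γ := Z) (by simpa using hA)
    exact step' (.four (.ofPath Z l) A Λ hc) (by simp [hΓ, add_assoc]) hX (by simp)
  · intro hX A G l' Λ hΓ' hA
    by_contra hc
    obtain ⟨Z, rfl⟩ := exists_eq_add_single hA
    obtain ⟨C, h₁, -, h₃, h₄⟩ := Ctx₂.exists_fill (hΓ'.symm.trans hΓ) hc
    exact step' (.five C A (by simp [h₃]) (by rwa [h₄])) (h₁.trans hΓ.symm) hX (by simp)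

end Sequent

/-- The accessibility relation between labels: the conditions on diamonds that the rules for `X`
impose. `D` is the set of the `A` such that `◇A` is everywhere. -/
structure LabelRel {P : Type u} (X : Set ModalAxiom) (D s t : Set (Formula P)) : Prop where
  k : ∀ A : Formula P, A.dia ∈ s → A ∈ t
  b : .b ∈ X → ∀ A : Formula P, A.dia ∈ t → A ∈ s
  four : .four ∈ X → ∀ A : Formula P, A.dia ∈ s → A.dia ∈ t
  five : .five ∈ X → ∀ A : Formula P, A.dia ∈ t → A ∈ D

/-- With the next two lemmas, this is all that the countermodel needs from 45-closedness. A
reflexive euclidean relation is symmetric, and for a symmetric relation transitivity and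
euclideanness are equivalent. -/
theorem FourFiveClosed.four_of_t {X : Set ModalAxiom} (hX : FourFiveClosed.{v} X) (h : .t ∈ X)
    (h5 : .five ∈ X) : .four ∈ X := by
  refine hX _ (.inl rfl) fun S _ R hR s t w hst htw => ?_
  exact hR _ h5 t s w (hR _ h5 s t s hst (hR _ h s)) htw

theorem FourFiveClosed.four_of_b {X : Set ModalAxiom} (hX : FourFiveClosed.{v} X) (h : .b ∈ X)
    (h5 : .five ∈ X) : .four ∈ X :=
  hX _ (.inl rfl) fun _ _ _ hR s t w hst htw => hR _ h5 t s w (hR _ h s t hst) htw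

theorem FourFiveClosed.five_of_b {X : Set ModalAxiom} (hX : FourFiveClosed.{v} X) (h : .b ∈ X)
    (h4 : .four ∈ X) : .five ∈ X :=
  hX _ (.inr rfl) fun _ _ _ hR s t w hst hsw => hR _ h4 t s w (hR _ h s t hst) hsw

open Sequent (plug label Emb Falsified) in
/-- The countermodel given by a saturated sequent `Γ` and a finite set `W` of labels each of which
is carried by a node in which `□°` and `◇d_c°` do not apply and whose children have labels in `W`.
It falsifies all sequents that embed into the part of `Γ` with labels in `W`. -/
theorem exists_countermodel {P : Type u} {X : Set ModalAxiom} (hX : FourFiveClosed.{v} X)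
    {Γ : Sequent P} (hax : ¬ Axiomatic Γ) (hstep : ∀ Γs, ¬ InstanceStep1 X Γ Γs)
    {W : Set (Set (Formula P))} (hfin : W.Finite)
    (hW : ∀ L ∈ W, ∃ l Δ, Γ = plug l Δ ∧ label Δ = L ∧ (∀ A, ¬ BoxApplies Δ A) ∧
      (.d ∈ X → ∀ A, ¬ DiaDApplies Δ A) ∧ ∀ Λ ∈ Δ.children, label Λ ∈ W)
    {n : ℕ} (hn : ∀ l Δ, Γ = plug l Δ → l.length ≤ n → label Δ ∈ W)
    {Γ₀ : Sequent P} (hΓ₀ : Emb Γ₀ Γ) (hw : Γ₀.weight ≤ n) :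
    ∃ (S : Type v) (_ : Nonempty S) (_ : Finite S) (R : S → S → Prop),
      IsFrame X R ∧ ∃ V s, Falsified R V Γ₀ s := by
  have sat : ∀ {l Δ}, Γ = plug l Δ → Sequent.SaturatedAt X Γ Δ :=
    fun h => Sequent.saturatedAt_of_not_step1 hax hstep h
  have hroot : label Γ ∈ W := hn [] Γ rfl (Nat.zero_le _)
  -- The labels live in the universe of `P`; indexing them by a lifted `Fin m` puts the states into
  -- the required universe.
  obtain ⟨m, ⟨e⟩⟩ := (Set.finite_coe_iff.2 hfin).exists_equiv_fin
  let lab : ULift.{v} (Fin m) → Set (Formula P) := fun s => (e.symm s.down).1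
  have hlab : ∀ s, lab s ∈ W := fun s => (e.symm s.down).2
  have hsurj : ∀ L ∈ W, ∃ s, lab s = L := fun L hL => ⟨⟨e ⟨L, hL⟩⟩, by simp [lab]⟩
  clear_value lab
  let D : Set (Formula P) := {A | ∀ l Δ, Γ = plug l Δ → A.dia ∈ Δ.formulas}
  have hD : ∀ s, ∀ A ∈ D, A.dia ∈ lab s := by
    intro s A hA
    obtain ⟨l, Δ, hΓ, hΔ, -⟩ := hW _ (hlab s)
    rw [← hΔ]
    exact hA l Δ hΓ
  have five_child : .five ∈ X → ∀ {G l Λ A}, Γ = plug (G :: l) Λ → A.dia ∈ Λ.formulas → A ∈ D :=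
    fun h5 G l Λ A hΓ hA _ _ hΔ => (sat hΔ).five h5 A G l Λ hΓ hA
  have edge : ∀ {l Δ Λ}, Γ = plug l Δ → Λ ∈ Δ.children →
      LabelRel X D (label Δ) (label Λ) := by
    intro l Δ Λ hΓ hΛ
    refine ⟨fun A hA => (sat hΓ).k A hA Λ hΛ, fun h A hA => (sat hΓ).b h A Λ hΛ hA,
      fun h A hA => (sat hΓ).four h A hA Λ hΛ, fun h A hA => ?_⟩
    obtain ⟨Z, rfl⟩ := Sequent.exists_eq_add_bracket hΛ
    rw [← Sequent.plug_append_singleton] at hΓ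
    -- A child is not the root, so the rule for 5 spreads its diamonds to all nodes.
    obtain ⟨G, l', hl⟩ := List.exists_cons_of_ne_nil (l := l ++ [Z]) (by simp)
    exact five_child h (hl ▸ hΓ) hA
  refine ⟨ULift.{v} (Fin m), ⟨(hsurj _ hroot).choose⟩, inferInstance,
    fun s t => LabelRel X D (lab s) (lab t), ?_, fun p => {s | .pos p ∉ lab s}, ?_⟩
  · rintro (_ | _ | _ | _ | _) hρ
    · intro s
      obtain ⟨l, Δ, hΓ, hΔ, -, hd, hc⟩ := hW _ (hlab s)
      by_cases h : Δ.children = 0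
      · have hno : ∀ A : Formula P, A.dia ∉ lab s := fun A hA =>
          hd hρ A ⟨by rwa [← hΔ] at hA, h⟩
        exact ⟨s, fun A hA => (hno A hA).elim, fun _ A hA => (hno A hA).elim,
          fun _ A hA => (hno A hA).elim, fun _ A hA => (hno A hA).elim⟩
      · obtain ⟨Λ, hΛ⟩ := Multiset.exists_mem_of_ne_zero h
        obtain ⟨t, ht⟩ := hsurj _ (hc Λ hΛ)
        exact ⟨t, by beta_reduce; rw [ht, ← hΔ]; exact edge hΓ hΛ⟩
    · intro s
      obtain ⟨l, Δ, hΓ, hΔ, -⟩ := hW _ (hlab s)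
      rw [← hΔ]
      refine ⟨(sat hΓ).t hρ, fun _ => (sat hΓ).t hρ, fun _ _ => id, fun h5 A hA => ?_⟩
      cases l with
      | cons G l => exact five_child h5 hΓ hA
      | nil =>
        obtain rfl : Γ = Δ := hΓ
        -- The rule for 5 does not start from the root. Either the root is the only node, or 4,
        -- which is available by closedness, moves the diamond to a child and 5 spreads it from
        -- there.
        by_cases h : Γ.children = 0
        · rintro (_ | ⟨G, l⟩) Δ' hΓ'
          · rwa [show Γ = Δ' from hΓ'] at hA
          · rw [hΓ'] at h
            simp [plug] at h
        · obtain ⟨Λ, hΛ⟩ := Multiset.exists_mem_of_ne_zero h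
          have e := edge (l := []) rfl hΛ
          exact e.five h5 A (e.four (hX.four_of_t hρ h5) A hA)
    · intro s t h
      refine ⟨h.b hρ, fun _ => h.k, fun h4 A hA => ?_, fun h5 A hA => ?_⟩
      · exact hD s A (h.five (hX.five_of_b hρ h4) A hA)
      · exact h.five h5 A (h.four (hX.four_of_b hρ h5) A hA)
    · intro s t w h h'
      refine ⟨fun A hA => h'.k A (h.four hρ A hA), fun hb A hA => ?_,
        fun _ A hA => h'.four hρ A (h.four hρ A hA), fun h5 => h'.five h5⟩
      exact h.b hb A (hD t A (h'.five (hX.five_of_b hb hρ) A hA))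
    · intro s t w h h'
      refine ⟨fun A hA => h'.k A (hD s A (h.five hρ A hA)),
        fun _ A hA => h.k A (hD s A (h'.five hρ A hA)),
        fun _ A hA => hD w A (h.five hρ A hA), fun _ => h'.five hρ⟩
  · have truth : ∀ A s, A ∈ lab s → ¬ Formula.Holds (fun s t => LabelRel X D (lab s) (lab t))
        (fun p => {s | .pos p ∉ lab s}) s A := by
      intro A
      induction A with
      | pos p => exact fun s hs h => h hs
      | neg p =>
        intro s hs h
        obtain ⟨l, Δ, hΓ, hΔ, -⟩ := hW _ (hlab s)
        rw [← hΔ] at hs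
        refine h fun hp => ?_
        rw [← hΔ] at hp
        exact (sat hΓ).ax p hp hs
      | or A B ihA ihB =>
        intro s hs h
        obtain ⟨l, Δ, hΓ, hΔ, -⟩ := hW _ (hlab s)
        have := (sat hΓ).or A B (by rwa [← hΔ] at hs)
        exact h.elim (ihA s (by rw [← hΔ]; exact this.1)) (ihB s (by rw [← hΔ]; exact this.2))
      | and A B ihA ihB =>
        intro s hs h
        obtain ⟨l, Δ, hΓ, hΔ, -⟩ := hW _ (hlab s)
        rcases (sat hΓ).and A B (by rwa [← hΔ] at hs) with hA | hB
        · exact ihA s (by rw [← hΔ]; exact hA) h.1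
        · exact ihB s (by rw [← hΔ]; exact hB) h.2
      | dia A ih =>
        rintro s hs ⟨t, hst, h⟩
        exact ih t (hst.k A hs) h
      | box A ih =>
        intro s hs h
        obtain ⟨l, Δ, hΓ, hΔ, hb, -, hc⟩ := hW _ (hlab s)
        rw [← hΔ] at hs
        have : ∃ Λ ∈ Δ.children, A ∈ Λ.formulas := by
          by_contra hcon
          push Not at hcon
          exact hb A ⟨hs, hcon⟩
        obtain ⟨Λ, hΛ, hA⟩ := this
        obtain ⟨t, ht⟩ := hsurj _ (hc Λ hΛ)
        refine ih t (by rw [ht]; exact hA) (h t ?_)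
        beta_reduce
        rw [ht, ← hΔ]
        exact edge hΓ hΛ
    obtain ⟨s₀, hs₀⟩ := hsurj _ hroot
    refine ⟨s₀, ?_⟩
    -- Depth plus remaining weight stays at most `n` on the way down, so every node reached has its
    -- label in `W`.
    suffices key : ∀ (Γ₀ : Sequent P) l Δ s, Γ = plug l Δ → lab s = label Δ → Emb Γ₀ Δ →
        l.length + Γ₀.weight ≤ n → Falsified (fun s t => LabelRel X D (lab s) (lab t))
          (fun p => {s | .pos p ∉ lab s}) Γ₀ s from
      key Γ₀ [] Γ s₀ rfl hs₀ hΓ₀ (by simpa using hw)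
    intro Γ₀
    induction hk : Γ₀.weight using Nat.strong_induction_on generalizing Γ₀ with
    | _ k ih =>
      subst hk
      intro l Δ s hΓ hs hE hl
      rw [Emb, Sequent.maps_iff] at hE
      refine Sequent.maps_iff.2 ⟨fun A hA => truth A s (hs ▸ hE.1 A hA), fun Λ hΛ => ?_⟩
      obtain ⟨Λ', hΛ', hE'⟩ := hE.2 Λ hΛ
      have hlt := Sequent.weight_lt_of_mem_children hΛ
      have hrel := edge hΓ hΛ'
      obtain ⟨Z, rfl⟩ := Sequent.exists_eq_add_bracket hΛ'
      rw [← Sequent.plug_append_singleton] at hΓ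
      obtain ⟨t, ht⟩ := hsurj _ (hn _ _ hΓ (by simp; omega))
      exact ⟨t, by rw [hs, ht]; exact hrel, ih _ hlt Λ rfl _ Λ' t hΓ ht hE' (by simp; omega)⟩

/-! ### Growth of sequents during proof search -/

section Growth

open Sequent (plug Emb maps_iff label)

variable {P : Type u} {X : Set ModalAxiom}

/-- `Γ'` arises from `Γ` by adding formulas to a node such that its set of formulas grows. -/
def Grows (Γ Γ' : Sequent P) : Prop :=
  ∃ l Δ E A, Γ = plug l Δ ∧ Γ' = plug l (Δ + E) ∧ E.children = 0 ∧ A ∈ E.formulas ∧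
    A ∉ Δ.formulas

theorem Grows.emb {Γ Γ' : Sequent P} (h : Grows Γ Γ') : Emb Γ Γ' := by
  obtain ⟨l, Δ, E, A, rfl, rfl, -⟩ := h
  exact (Emb.add_right _ _).plug

/-- Step 1 creates no nodes, and the proviso of the rule provides the new formula. For `k` and `4`
the growing node is the child, so the path is one step longer. -/
theorem InstanceStep1.grows {Γ Γ' : Sequent P} {Γs : List (Sequent P)}
    (h : InstanceStep1 X Γ Γs) (hΓ' : Γ' ∈ Γs) : Grows Γ Γ' := by
  obtain ⟨ρ, -, h₁, h₂, h⟩ := h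
  cases h with
  | and C A B hA hB =>
    obtain ⟨l, -, hC⟩ := C.exists_plug
    simp only [hC, List.mem_cons, List.not_mem_nil, or_false] at hΓ' ⊢
    rcases hΓ' with rfl | rfl
    · exact ⟨l, _, single A, A, rfl, by rw [add_assoc], rfl, by simp, hA⟩
    · exact ⟨l, _, single B, B, rfl, by rw [add_assoc], rfl, by simp, hB⟩
  | or C A B h =>
    obtain ⟨l, -, hC⟩ := C.exists_plug
    simp only [hC, List.mem_cons, List.not_mem_nil, or_false] at hΓ' ⊢
    subst hΓ'
    rcases h with h | h
    · exact ⟨l, _, single A + single B, A, rfl, by simp only [add_assoc], rfl, by simp, h⟩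
    · exact ⟨l, _, single A + single B, B, rfl, by simp only [add_assoc], rfl, by simp, h⟩
  | box => exact absurd rfl h₁
  | k C A Δ h =>
    obtain ⟨l, -, hC⟩ := C.exists_plug
    simp only [hC, List.mem_cons, List.not_mem_nil, or_false, ← add_assoc,
      ← Sequent.plug_append_singleton] at hΓ' ⊢
    exact ⟨_, _, single A, A, rfl, hΓ', rfl, by simp, h⟩
  | d => exact absurd rfl h₂
  | t C A h =>
    obtain ⟨l, -, hC⟩ := C.exists_plug
    simp only [hC, List.mem_cons, List.not_mem_nil, or_false, ← add_assoc] at hΓ' ⊢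
    exact ⟨_, _, single A, A, rfl, hΓ', rfl, by simp, h⟩
  | b C A Δ h =>
    obtain ⟨l, -, hC⟩ := C.exists_plug
    simp only [hC, List.mem_cons, List.not_mem_nil, or_false, ← add_assoc (C.beside)] at hΓ' ⊢
    exact ⟨_, _, single A, A, rfl, hΓ', rfl, by simp, by simpa using h⟩
  | four C A Δ h =>
    obtain ⟨l, -, hC⟩ := C.exists_plug
    simp only [hC, List.mem_cons, List.not_mem_nil, or_false, ← add_assoc,
      ← Sequent.plug_append_singleton] at hΓ' ⊢
    exact ⟨_, _, single A.dia, A.dia, rfl, hΓ', rfl, by simp, h⟩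
  | five C A hC h =>
    obtain ⟨l, -, hC⟩ := (C.fillFst (single A.dia)).exists_plug
    simp only [Ctx₂.fill, hC, List.mem_cons, List.not_mem_nil, or_false, add_zero] at hΓ' ⊢
    exact ⟨_, _, single A.dia, A.dia, rfl, hΓ', rfl, by simp, h⟩

end Growth

/-! ### Failing runs -/

section Run

open Sequent (plug Emb maps_iff label)

variable {P : Type u} {X : Set ModalAxiom}

theorem Sequent.formulas_ofParts (As : Multiset (Formula P)) (Δs : Multiset (Sequent P)) :
    (Sequent.ofParts As Δs).formulas = As := by
  have h₁ : (As.map single).sum.formulas = As := by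
    induction As using Multiset.induction with
    | empty => simp
    | cons A As ih => simp [ih, Multiset.singleton_add]
  have h₂ : (Δs.map bracket).sum.formulas = 0 := by
    induction Δs using Multiset.induction with
    | empty => simp
    | cons Δ Δs ih => simp [ih]
  simp [Sequent.ofParts, h₁, h₂]

theorem Sequent.children_ofParts (As : Multiset (Formula P)) (Δs : Multiset (Sequent P)) :
    (Sequent.ofParts As Δs).children = Δs := by
  have h₁ : (As.map single).sum.children = 0 := by
    induction As using Multiset.induction with
    | empty => simp
    | cons A As ih => simp [ih]
  have h₂ : (Δs.map bracket).sum.children = Δs := by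
    induction Δs using Multiset.induction with
    | empty => simp
    | cons Δ Δs ih => simp [ih, Multiset.singleton_add]
  simp [Sequent.ofParts, h₁, h₂]

theorem Expand.emb {Γ Γ' : Sequent P} (h : Expand X Γ Γ') : Emb Γ Γ' := by
  induction hn : Γ.weight using Nat.strong_induction_on generalizing Γ Γ' with
  | _ n ih =>
    subst hn
    obtain ⟨hrel, hroot, -⟩ := h
    rename_i As Δs Δs'
    have : Emb (Sequent.ofParts As Δs) (Sequent.ofParts As Δs') := by
      refine maps_iff.2 ⟨by simp [Sequent.formulas_ofParts], fun Λ hΛ => ?_⟩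
      have hlt := Sequent.weight_lt_of_mem_children hΛ
      rw [Sequent.children_ofParts] at hΛ
      obtain ⟨Λ', hΛ', h⟩ := Multiset.exists_mem_of_rel_of_mem hrel hΛ
      exact ⟨Λ', by rwa [Sequent.children_ofParts], ih _ hlt h rfl⟩
    refine this.trans ?_
    clear this
    induction hroot with
    | refl => exact .refl _
    | tail _ h ih' =>
      obtain ⟨A, -, rfl⟩ := h
      exact ih'.trans (.add_right _ _)

theorem Phase1.emb {L L' : Multiset (Sequent P)} (h : Phase1 X L L') :
    ∀ Δ ∈ L', ∃ Γ ∈ L, Emb Γ Δ := by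
  obtain ⟨h, -⟩ := h
  induction h with
  | refl => exact fun Δ hΔ => ⟨Δ, hΔ, .refl Δ⟩
  | tail _ h ih =>
    obtain ⟨Γ, Γs, L₀, rfl, -, -, hi, rfl⟩ := h
    intro Δ hΔ
    rcases Multiset.mem_add.1 hΔ with hΔ | hΔ
    · obtain ⟨Γ₀, hΓ₀, h⟩ := ih Γ (Multiset.mem_cons_self _ _)
      exact ⟨Γ₀, hΓ₀, h.trans (hi.grows hΔ).emb⟩
    · exact ih Δ (Multiset.mem_cons_of_mem hΔ)

theorem Phase2.emb {L L' : Multiset (Sequent P)} (h : Phase2 X L L') :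
    ∀ Δ ∈ L', ∃ Γ ∈ L, Emb Γ Δ := by
  intro Δ hΔ
  obtain ⟨Γ, hΓ, h⟩ := Multiset.exists_mem_of_rel_of_mem (Multiset.rel_flip.2 h) hΔ
  rcases h with ⟨-, rfl⟩ | ⟨-, h⟩
  · exact ⟨_, hΓ, .refl _⟩
  · exact ⟨Γ, hΓ, h.emb⟩

theorem Run.emb {L L' : Multiset (Sequent P)} (h : Run X L L') :
    ∀ Δ ∈ L', ∃ Γ ∈ L, Emb Γ Δ := by
  induction h with
  | last h₁ h₂ =>
    intro Δ hΔ
    obtain ⟨Γ, hΓ, h⟩ := h₂.emb Δ hΔ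
    obtain ⟨Γ', hΓ', h'⟩ := h₁.emb Γ hΓ
    exact ⟨Γ', hΓ', h'.trans h⟩
  | again h₁ h₂ _ _ ih =>
    intro Δ hΔ
    obtain ⟨Γ₂, hΓ₂, h'⟩ := ih Δ hΔ
    obtain ⟨Γ, hΓ, h⟩ := h₂.emb Γ₂ hΓ₂
    obtain ⟨Γ', hΓ', h''⟩ := h₁.emb Γ hΓ
    exact ⟨Γ', hΓ', h''.trans (h.trans h')⟩

theorem Run.done {L L' : Multiset (Sequent P)} (h : Run X L L') : Done X L' := by
  induction h with
  | last _ _ h => exact h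
  | again _ _ _ _ ih => exact ih

theorem Sequent.finite_subtreeOf (Γ : Sequent P) : {Δ | Sequent.SubtreeOf Δ Γ}.Finite := by
  induction hn : Γ.weight using Nat.strong_induction_on generalizing Γ with
  | _ n ih =>
    subst hn
    have hfin : {Λ | Λ ∈ Γ.children}.Finite := by
      classical
      exact (Γ.children.toFinset.finite_toSet).subset fun Λ hΛ => by simpa using hΛ
    refine ((Set.finite_singleton Γ).union (hfin.biUnion fun Λ hΛ =>
      ih _ (Sequent.weight_lt_of_mem_children hΛ) Λ rfl)).subset ?_
    intro Δ hΔ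
    cases hΔ with
    | refl => exact .inl rfl
    | child hΛ h => exact .inr (Set.mem_biUnion hΛ h)

theorem ProveFails.exists_countermodel [Nonempty P] (hX : FourFiveClosed.{v} X) {Γ : Sequent P}
    (h : ProveFails X Γ) : ∃ (S : Type v) (_ : Nonempty S) (_ : Finite S) (R : S → S → Prop),
      IsFrame X R ∧ ¬ Γ.ValidInFrame R := by
  obtain ⟨L, hrun, Γ', hΓ', hax⟩ := h
  obtain ⟨Γ₀, hΓ₀, hemb⟩ := hrun.emb Γ' hΓ'
  rw [Multiset.mem_singleton.1 hΓ₀] at hemb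
  have hfin := hrun.done Γ' hΓ' hax
  obtain ⟨S, hne, hS, R, hR, V, s, hf⟩ := NestedSequents.exists_countermodel hX hax hfin.1
    (W := label '' {Δ | Sequent.SubtreeOf Δ Γ'}) (Γ'.finite_subtreeOf.image _) (by
      rintro _ ⟨Δ, hΔ, rfl⟩
      -- A cyclic leaf is replaced by the inner node with the same label, which is no leaf and hence
      -- is itself fully expanded.
      have : ∃ Λ : Sequent P, Λ.SubtreeOf Γ' ∧ label Λ = label Δ ∧ (∀ A, ¬ BoxApplies Λ A) ∧
          (.d ∈ X → ∀ A, ¬ DiaDApplies Λ A) := by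
        rcases hfin.2 Δ hΔ with ⟨-, Λ, hΛ, hne, hl⟩ | h
        · rcases hfin.2 Λ hΛ with h | h
          · exact absurd h.1 hne
          · exact ⟨Λ, hΛ, Set.ext hl, h⟩
        · exact ⟨Δ, hΔ, rfl, h⟩
      obtain ⟨Λ, hΛ, hl, hb, hd⟩ := this
      obtain ⟨l, rfl⟩ := hΛ.exists_plug
      refine ⟨l, Λ, rfl, hl, hb, hd, fun M hM => ⟨M, ?_, rfl⟩⟩
      obtain ⟨Z, rfl⟩ := Sequent.exists_eq_add_bracket hM
      rw [← Sequent.plug_append_singleton]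
      exact .plug _ _) (n := Γ.weight)
    (by rintro l Δ rfl -; exact ⟨Δ, .plug _ _, rfl⟩) hemb le_rfl
  exact ⟨S, hne, hS, R, hR, hf.not_validInFrame⟩

end Run

/-! ### Subformulas -/

section Within

open Sequent (plug Emb maps_iff maps_add maps_bracket label Maps)

variable {P : Type u} {X : Set ModalAxiom}

/-- A set of formulas is closed under immediate subformulas. -/
structure SubformulaClosed (F : Set (Formula P)) : Prop where
  or : ∀ A B, Formula.or A B ∈ F → A ∈ F ∧ B ∈ F
  and : ∀ A B, Formula.and A B ∈ F → A ∈ F ∧ B ∈ F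
  dia : ∀ A, Formula.dia A ∈ F → A ∈ F
  box : ∀ A, Formula.box A ∈ F → A ∈ F

theorem SubformulaClosed.union {F G : Set (Formula P)} (hF : SubformulaClosed F)
    (hG : SubformulaClosed G) : SubformulaClosed (F ∪ G) where
  or A B h := h.elim (fun h => (hF.or A B h).imp .inl .inl) fun h => (hG.or A B h).imp .inr .inr
  and A B h := h.elim (fun h => (hF.and A B h).imp .inl .inl) fun h => (hG.and A B h).imp .inr .inr
  dia A h := h.imp (hF.dia A) (hG.dia A)
  box A h := h.imp (hF.box A) (hG.box A)

theorem Formula.exists_subformulaClosed (A : Formula P) :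
    ∃ F : Set (Formula P), F.Finite ∧ SubformulaClosed F ∧ A ∈ F := by
  induction A with
  | pos p => exact ⟨{.pos p}, Set.finite_singleton _, by constructor <;> simp, rfl⟩
  | neg p => exact ⟨{.neg p}, Set.finite_singleton _, by constructor <;> simp, rfl⟩
  | or A B ihA ihB =>
    obtain ⟨F, hF, hFc, hA⟩ := ihA
    obtain ⟨G, hG, hGc, hB⟩ := ihB
    have h := hFc.union hGc
    refine ⟨insert (.or A B) (F ∪ G), (hF.union hG).insert _, ⟨?_, ?_, ?_, ?_⟩, .inl rfl⟩
    · rintro C D (⟨⟨⟩⟩ | hC)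
      exacts [⟨.inr (.inl hA), .inr (.inr hB)⟩, (h.or C D hC).imp .inr .inr]
    · rintro C D (⟨⟨⟩⟩ | hC)
      exact (h.and C D hC).imp .inr .inr
    · rintro C (⟨⟨⟩⟩ | hC)
      exact .inr (h.dia C hC)
    · rintro C (⟨⟨⟩⟩ | hC)
      exact .inr (h.box C hC)
  | and A B ihA ihB =>
    obtain ⟨F, hF, hFc, hA⟩ := ihA
    obtain ⟨G, hG, hGc, hB⟩ := ihB
    have h := hFc.union hGc
    refine ⟨insert (.and A B) (F ∪ G), (hF.union hG).insert _, ⟨?_, ?_, ?_, ?_⟩, .inl rfl⟩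
    · rintro C D (⟨⟨⟩⟩ | hC)
      exact (h.or C D hC).imp .inr .inr
    · rintro C D (⟨⟨⟩⟩ | hC)
      exacts [⟨.inr (.inl hA), .inr (.inr hB)⟩, (h.and C D hC).imp .inr .inr]
    · rintro C (⟨⟨⟩⟩ | hC)
      exact .inr (h.dia C hC)
    · rintro C (⟨⟨⟩⟩ | hC)
      exact .inr (h.box C hC)
  | dia A ih =>
    obtain ⟨F, hF, h, hA⟩ := ih
    refine ⟨insert (.dia A) F, hF.insert _, ⟨?_, ?_, ?_, ?_⟩, .inl rfl⟩
    · rintro C D (⟨⟨⟩⟩ | hC)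
      exact (h.or C D hC).imp .inr .inr
    · rintro C D (⟨⟨⟩⟩ | hC)
      exact (h.and C D hC).imp .inr .inr
    · rintro C (⟨⟨⟩⟩ | hC)
      exacts [.inr hA, .inr (h.dia C hC)]
    · rintro C (⟨⟨⟩⟩ | hC)
      exact .inr (h.box C hC)
  | box A ih =>
    obtain ⟨F, hF, h, hA⟩ := ih
    refine ⟨insert (.box A) F, hF.insert _, ⟨?_, ?_, ?_, ?_⟩, .inl rfl⟩
    · rintro C D (⟨⟨⟩⟩ | hC)
      exact (h.or C D hC).imp .inr .inr
    · rintro C D (⟨⟨⟩⟩ | hC)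
      exact (h.and C D hC).imp .inr .inr
    · rintro C (⟨⟨⟩⟩ | hC)
      exact .inr (h.dia C hC)
    · rintro C (⟨⟨⟩⟩ | hC)
      exacts [.inr hA, .inr (h.box C hC)]

namespace Sequent

/-- All formulas in the nodes of `Γ` belong to `F`. -/
def Within (F : Set (Formula P)) (Γ : Sequent P) : Prop :=
  Maps (fun A (_ : Unit) => A ∈ F) (fun _ _ => True) Γ ()

variable {F G : Set (Formula P)} {Γ Δ : Sequent P} {A : Formula P}

@[simp] theorem within_single : Within F (single A) ↔ A ∈ F := Iff.rfl

@[simp] theorem within_add : Within F (Γ + Δ) ↔ Within F Γ ∧ Within F Δ := maps_add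

@[simp] theorem within_bracket : Within F (bracket Γ) ↔ Within F Γ := by
  simp only [Within, maps_bracket, true_and]
  exact ⟨fun ⟨_, h⟩ => h, fun h => ⟨(), h⟩⟩

@[simp] theorem within_plug {l : List (Sequent P)} :
    Within F (plug l Δ) ↔ (∀ Γ ∈ l, Within F Γ) ∧ Within F Δ := by
  induction l with
  | nil => simp [plug]
  | cons Γ l ih => simp [plug, ih, and_assoc]

theorem Within.mem (h : Within F Γ) (hA : A ∈ Γ.formulas) : A ∈ F := (maps_iff.1 h).1 A hA

theorem Within.mono (h : Within F Γ) (hFG : F ⊆ G) : Within G Γ := by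
  induction Γ using Sequent.induction with
  | zero => trivial
  | single A => exact hFG h
  | add Γ Δ ih ih' => exact within_add.2 ⟨ih (within_add.1 h).1, ih' (within_add.1 h).2⟩
  | bracket Γ ih => exact within_bracket.2 (ih (within_bracket.1 h))

theorem exists_within (Γ : Sequent P) :
    ∃ F : Set (Formula P), F.Finite ∧ SubformulaClosed F ∧ Within F Γ := by
  induction Γ using Sequent.induction with
  | zero => exact ⟨∅, Set.finite_empty, by constructor <;> simp, trivial⟩
  | single A => exact A.exists_subformulaClosed
  | add Γ Δ ih ih' =>
    obtain ⟨F, hF, hFc, hΓ⟩ := ih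
    obtain ⟨G, hG, hGc, hΔ⟩ := ih'
    exact ⟨F ∪ G, hF.union hG, hFc.union hGc, within_add.2
      ⟨hΓ.mono Set.subset_union_left, hΔ.mono Set.subset_union_right⟩⟩
  | bracket Γ ih => simpa using ih

end Sequent

open Sequent (Within)

theorem Ctx.fill_within {F : Set (Formula P)} {C : Ctx P} {Y Z : Sequent P}
    (h : Within F (C.fill Y)) (hZ : Within F Y → Within F Z) : Within F (C.fill Z) := by
  obtain ⟨l, -, hC⟩ := C.exists_plug
  simp only [hC, Sequent.within_plug, Sequent.within_add] at h ⊢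
  exact ⟨h.1, h.2.1, hZ h.2.2⟩

theorem InstanceO.within {F : Set (Formula P)} (hF : SubformulaClosed F) {ρ : RuleName}
    {Γ Γ' : Sequent P} {Γs : List (Sequent P)} (h : InstanceO ρ Γ Γs) (hΓ : Within F Γ)
    (hΓ' : Γ' ∈ Γs) : Within F Γ' := by
  cases h with
  | and C A B =>
    have hAB := hF.and A B
    simp only [List.mem_cons, List.not_mem_nil, or_false] at hΓ'
    rcases hΓ' with rfl | rfl <;> exact Ctx.fill_within hΓ (by simp; tauto)
  | or C A B =>
    have hAB := hF.or A B
    simp only [List.mem_cons, List.not_mem_nil, or_false] at hΓ'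
    subst hΓ'
    exact Ctx.fill_within hΓ (by simp; tauto)
  | box C A =>
    have hA := hF.box A
    simp only [List.mem_cons, List.not_mem_nil, or_false] at hΓ'
    subst hΓ'
    exact Ctx.fill_within hΓ (by simp; tauto)
  | k C A | d C A | t C A | b C A | four C A =>
    have hA := hF.dia A
    simp only [List.mem_cons, List.not_mem_nil, or_false] at hΓ'
    subst hΓ'
    exact Ctx.fill_within hΓ (by simp; try tauto)
  | five C A =>
    simp only [List.mem_cons, List.not_mem_nil, or_false] at hΓ'
    subst hΓ'
    -- The diamond is read off at the first hole, which the context for the second hole hides.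
    have hA : A.dia ∈ F := by
      rw [Ctx₂.fill_eq] at hΓ
      obtain ⟨l, -, hC⟩ := (C.fillSnd 0).exists_plug
      simp only [hC, Sequent.within_plug, Sequent.within_add] at hΓ
      exact hΓ.2.2
    exact Ctx.fill_within hΓ fun _ => hA

end Within

/-! ### Termination of bounded proof search -/

section Potential

open Sequent (plug Emb label Within)

variable {P : Type u} {X : Set ModalAxiom}

/-- A bound for the number of formulas from a set of `c` formulas and of nodes that can be created
in a new subtree of depth less than `n`. -/
def subtreeCost (c : ℕ) : ℕ → ℕ
  | 0 => 0
  | n + 1 => c + c * subtreeCost c n + 1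

/-- A bound for the number of steps of proof search that add formulas from `F` to nodes of `Γ`, or
nodes at depth at most `n`. -/
noncomputable def potential (F : Set (Formula P)) (n : ℕ) (Γ : Sequent P) : ℕ :=
  {A ∈ F | A ∉ Γ.formulas}.ncard +
    (Γ.children.attach.map fun Λ => potential F (n - 1) Λ.1).sum +
    {A ∈ F | ∀ Λ ∈ Γ.children, A ∉ Λ.formulas}.ncard * subtreeCost F.ncard n
termination_by Γ.weight
decreasing_by exact Sequent.weight_lt_of_mem_children Λ.2

theorem potential_eq (F : Set (Formula P)) (n : ℕ) (Γ : Sequent P) : potential F n Γ =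
    {A ∈ F | A ∉ Γ.formulas}.ncard + (Γ.children.map (potential F (n - 1))).sum +
      {A ∈ F | ∀ Λ ∈ Γ.children, A ∉ Λ.formulas}.ncard * subtreeCost F.ncard n := by
  rw [potential]
  congr 3
  exact Multiset.attach_map_val' _ _

variable {F : Set (Formula P)} {n : ℕ} {Γ Δ Δ' : Sequent P}

/-- The potential of a subtree is a summand of that of its parent, with one unit less of depth
budget. The formulas still missing in all children do not increase in number, provided that the root
of the subtree loses no formula; this is why `hl` is carried along the induction. -/
theorem potential_plug_lt (hF : F.Finite) {l : List (Sequent P)}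
    (h : potential F (n - l.length) Δ' < potential F (n - l.length) Δ)
    (hl : ∀ A ∈ Δ.formulas, A ∈ Δ'.formulas) :
    potential F n (plug l Δ') < potential F n (plug l Δ) := by
  suffices h : potential F n (plug l Δ') < potential F n (plug l Δ) ∧
    ∀ A ∈ (plug l Δ).formulas, A ∈ (plug l Δ').formulas from h.1
  induction l generalizing n with
  | nil => exact ⟨by simpa [plug] using h, hl⟩
  | cons Γ l ih =>
    obtain ⟨h₁, h₂⟩ := ih (n := n - 1) (by simpa [Nat.sub_sub, add_comm] using h)
    refine ⟨?_, by simp [plug]⟩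
    rw [potential_eq, potential_eq F n (plug (Γ :: l) Δ)]
    have hle : {A ∈ F | ∀ Λ ∈ (plug (Γ :: l) Δ').children, A ∉ Λ.formulas}.ncard ≤
        {A ∈ F | ∀ Λ ∈ (plug (Γ :: l) Δ).children, A ∉ Λ.formulas}.ncard := by
      refine Set.ncard_le_ncard (fun A hA => ⟨hA.1, fun Λ hΛ hAΛ => ?_⟩) (hF.sep _)
      simp only [plug, Sequent.children_add, Sequent.children_bracket, Multiset.mem_add,
        Multiset.mem_singleton] at hΛ
      rcases hΛ with hΛ | rfl
      · exact hA.2 Λ (by simp [plug, hΛ]) hAΛ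
      · exact hA.2 (plug l Δ') (by simp [plug]) (h₂ A hAΛ)
    have hle := Nat.mul_le_mul_right (subtreeCost F.ncard n) hle
    have hs : ((plug (Γ :: l) Δ').children.map (potential F (n - 1))).sum <
        ((plug (Γ :: l) Δ).children.map (potential F (n - 1))).sum := by
      simpa [plug] using h₁
    have hf : (plug (Γ :: l) Δ').formulas = (plug (Γ :: l) Δ).formulas := by simp [plug]
    rw [hf]
    omega

theorem Grows.potential_lt (hF : F.Finite) {Γ' : Sequent P} (h : Grows Γ Γ')
    (hΓ' : Within F Γ') : potential F n Γ' < potential F n Γ := by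
  obtain ⟨l, Δ, E, A, rfl, rfl, hE, hA, hA'⟩ := h
  refine potential_plug_lt hF ?_ (by simp +contextual)
  rw [potential_eq, potential_eq F _ Δ]
  have hAF : A ∈ F := (Sequent.within_plug.1 hΓ').2.mem (by simp [hA])
  have hlt : {B ∈ F | B ∉ (Δ + E).formulas}.ncard < {B ∈ F | B ∉ Δ.formulas}.ncard := by
    refine Set.ncard_lt_ncard ⟨fun B hB => ⟨hB.1, fun h => hB.2 (by simp [h])⟩, fun h => ?_⟩
      (hF.sep _)
    exact (h ⟨hAF, hA'⟩).2 (by simp [hA])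
  rw [Sequent.children_add, hE, add_zero]
  omega

/-- At most `F.ncard` formulas can be added to the new node and as many children created below it;
the final `+ 1` in `subtreeCost` pays for the node itself and makes the inequality strict. -/
theorem potential_single_lt (hF : F.Finite) (A : Formula P) :
    potential F n (single A) < subtreeCost F.ncard (n + 1) := by
  rw [potential_eq]
  have h₁ : {B ∈ F | B ∉ (single A).formulas}.ncard ≤ F.ncard :=
    Set.ncard_le_ncard (Set.sep_subset _ _) hF
  have h₂ : {B ∈ F | ∀ Λ ∈ (single A).children, B ∉ Λ.formulas}.ncard ≤ F.ncard :=
    Set.ncard_le_ncard (Set.sep_subset _ _) hF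
  have h₂ := Nat.mul_le_mul_right (subtreeCost F.ncard n) h₂
  simp only [Sequent.children_single, Multiset.map_zero, Multiset.sum_zero, subtreeCost] at h₂ ⊢
  omega

/-- The new child removes `A` from the formulas missing in all children. This frees one
`subtreeCost`, which exceeds the potential of the new child. -/
theorem potential_add_bracket_lt (hF : F.Finite) {l : List (Sequent P)} (hl : l.length < n)
    {A : Formula P} (hA : A ∈ F) (hΔ : ∀ Λ ∈ Δ.children, A ∉ Λ.formulas) :
    potential F n (plug l (Δ + bracket (single A))) < potential F n (plug l Δ) := by
  refine potential_plug_lt hF ?_ (by simp)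
  obtain ⟨k, hk⟩ := Nat.exists_eq_add_of_lt hl
  obtain rfl : n = k + 1 + l.length := by omega
  simp only [Nat.add_sub_cancel]
  rw [potential_eq, potential_eq F _ Δ]
  have hlt : {B ∈ F | ∀ Λ ∈ (Δ + bracket (single A)).children, B ∉ Λ.formulas}.ncard <
      {B ∈ F | ∀ Λ ∈ Δ.children, B ∉ Λ.formulas}.ncard := by
    refine Set.ncard_lt_ncard ⟨fun B hB => ⟨hB.1, fun Λ hΛ => hB.2 Λ (by simp [hΛ])⟩, fun h => ?_⟩
      (hF.sep _)
    exact (h ⟨hA, hΔ⟩).2 (single A) (by simp) (by simp)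
  have hmul := Nat.mul_le_mul_right (subtreeCost F.ncard (k + 1)) (Nat.succ_le_of_lt hlt)
  rw [Nat.succ_mul] at hmul
  have := potential_single_lt (n := k) hF A
  simp only [Sequent.formulas_add, Sequent.formulas_bracket, add_zero, Sequent.children_add,
    Sequent.children_bracket, Multiset.map_add, Multiset.map_singleton, Multiset.sum_add,
    Multiset.sum_singleton, Nat.add_sub_cancel] at hmul ⊢
  omega

/-- An unprovable sequent extends to an unprovable sequent to which no rule of step 1 applies, and
neither `□°` nor `◇d_c°` at depth less than `n`. -/
theorem exists_saturated_of_not_provable (hF : F.Finite) (hFc : SubformulaClosed F) (n : ℕ)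
    (hΓ : Within F Γ) (h : ¬ Provable X Γ) :
    ∃ Γ', Emb Γ Γ' ∧ Within F Γ' ∧ ¬ Provable X Γ' ∧ (∀ Γs, ¬ InstanceStep1 X Γ' Γs) ∧
      ∀ l Δ, Γ' = plug l Δ → l.length < n →
        (∀ A, ¬ BoxApplies Δ A) ∧ (.d ∈ X → ∀ A, ¬ DiaDApplies Δ A) := by
  induction hp : potential F n Γ using Nat.strong_induction_on generalizing Γ with
  | _ p ih =>
    subst hp
    by_cases hstep : ∃ Γs, InstanceStep1 X Γ Γs
    · obtain ⟨Γs, hstep⟩ := hstep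
      obtain ⟨ρ, hρ, h₁, h₂, hi⟩ := id hstep
      obtain ⟨Γ₁, hmem, hΓ₁⟩ : ∃ Γ₁ ∈ Γs, ¬ Provable X Γ₁ := by
        by_contra! hcon
        exact h (hi.provable hρ hcon)
      have hw := hi.within hFc hΓ hmem
      have hg := hstep.grows hmem
      obtain ⟨Γ', hE, h'⟩ := ih _ (hg.potential_lt hF hw) hw hΓ₁ rfl
      exact ⟨Γ', hg.emb.trans hE, h'⟩
    -- The common part of `□°` and `◇d_c°`: both add a child `[A]` where no child contains `A`,
    -- which for `◇d_c°` holds because there is no child.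
    · have expand : ∀ {ρ l Δ A}, Γ = plug l Δ → l.length < n →
          (∀ Λ ∈ Δ.children, A ∉ Λ.formulas) → ρ ∈ system X →
          InstanceO ρ Γ [plug l (Δ + bracket (single A))] →
          ∃ Γ', Emb Γ Γ' ∧ Within F Γ' ∧ ¬ Provable X Γ' ∧ (∀ Γs, ¬ InstanceStep1 X Γ' Γs) ∧
            ∀ l Δ, Γ' = plug l Δ → l.length < n →
              (∀ A, ¬ BoxApplies Δ A) ∧ (.d ∈ X → ∀ A, ¬ DiaDApplies Δ A) := by
        rintro ρ l Δ A rfl hl hA hρ hi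
        have hw := hi.within hFc hΓ (List.mem_singleton_self _)
        have hAF : A ∈ F := by simpa using (Sequent.within_add.1 (Sequent.within_plug.1 hw).2).2
        obtain ⟨Γ', hE, h'⟩ := ih _ (potential_add_bracket_lt hF hl hAF hA) hw
          (fun hpr => h (hi.provable hρ (by simpa using hpr))) rfl
        exact ⟨Γ', ((Emb.add_right _ _).plug).trans hE, h'⟩
      by_cases hex : ∃ l Δ A, Γ = plug l Δ ∧ l.length < n ∧
          (BoxApplies Δ A ∨ .d ∈ X ∧ DiaDApplies Δ A)
      · obtain ⟨l, Δ, A, rfl, hl, hA | ⟨hd, hA⟩⟩ := hex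
        · refine expand (ρ := .box) (A := A) rfl hl hA.2 (by simp [system]) ?_
          obtain ⟨Z, rfl⟩ := Sequent.exists_eq_add_single hA.1
          simpa [add_assoc] using InstanceO.box (Ctx.ofPath Z l) A (by simpa using hA)
        · refine expand (ρ := .modal .d) (A := A) rfl hl (by simp [hA.2])
            (modal_mem_system.2 hd) ?_
          obtain ⟨Z, rfl⟩ := Sequent.exists_eq_add_single hA.1
          simpa [add_assoc] using InstanceO.d (Ctx.ofPath Z l) A (by simpa using hA)
      · refine ⟨Γ, .refl Γ, hΓ, h, fun Γs hΓs => hstep ⟨Γs, hΓs⟩, fun l Δ hΔ hl => ⟨?_, ?_⟩⟩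
        · exact fun A hA => hex ⟨l, Δ, A, hΔ, hl, .inl hA⟩
        · exact fun hd A hA => hex ⟨l, Δ, A, hΔ, hl, .inr ⟨hd, hA⟩⟩

end Potential

/-! ### Completeness -/

/-- Otherwise each of `T.ncard + 1` steps would add an element, too many for `T`. -/
theorem exists_eq_succ_of_monotone {α : Type*} {T : Set α} (hT : T.Finite) {f : ℕ → Set α}
    (hf : Monotone f) (hfT : ∀ n, f n ⊆ T) : ∃ n ≤ T.ncard, f n = f (n + 1) := by
  by_contra! h
  have key : ∀ n ≤ T.ncard + 1, n ≤ (f n).ncard := by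
    intro n
    induction n with
    | zero => simp
    | succ n ih =>
      intro hn
      have hlt : (f n).ncard < (f (n + 1)).ncard :=
        Set.ncard_lt_ncard ((hf n.le_succ).ssubset_of_ne (h n (by omega))) (hT.subset (hfT _))
      have := ih (by omega)
      omega
  have h₁ := key _ le_rfl
  have h₂ := Set.ncard_le_ncard (hfT (T.ncard + 1)) hT
  omega

open Sequent (plug Emb label Within) in
-- The depth at which the labels become stationary takes over the role of cyclic leaves: nodes
-- further down may be unexpanded, but their labels are not needed.
theorem exists_countermodel_of_not_provable {P : Type u} [Nonempty P] {X : Set ModalAxiom}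
    (hX : FourFiveClosed.{v} X) {Γ : Sequent P} (h : ¬ Provable X Γ) :
    ∃ (S : Type v) (_ : Nonempty S) (_ : Finite S) (R : S → S → Prop),
      IsFrame X R ∧ ¬ Γ.ValidInFrame R := by
  obtain ⟨F, hF, hFc, hΓ⟩ := Γ.exists_within
  obtain ⟨Γ', hE, hw, hnp, hstep, hexp⟩ := exists_saturated_of_not_provable hF hFc
    -- The image of `Γ` lies within depth `Γ.weight`, and at most `(𝒫 F).ncard` further levels pass
    -- before the labels are stationary; the `+ 1` makes the depth bound for expansion strict.
    (Γ.weight + (𝒫 F).ncard + 1) hΓ h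
  let W : ℕ → Set (Set (Formula P)) := fun k =>
    {L | ∃ l Δ, Γ' = plug l Δ ∧ l.length ≤ Γ.weight + k ∧ label Δ = L}
  have hWF : ∀ k, W k ⊆ 𝒫 F := by
    rintro k _ ⟨l, Δ, rfl, -, rfl⟩ A hA
    exact (Sequent.within_plug.1 hw).2.mem hA
  obtain ⟨k, hk, hWk⟩ := exists_eq_succ_of_monotone hF.powerset (f := W)
    (by rintro i j hij L ⟨l, Δ, hΔ, hl, hL⟩; exact ⟨l, Δ, hΔ, by omega, hL⟩) hWF
  obtain ⟨S, hne, hS, R, hR, V, s, hf⟩ := exists_countermodel hX (fun hax => hnp (.ax hax)) hstep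
    (W := W k) (hF.powerset.subset (hWF k)) (by
      rintro _ ⟨l, Δ, rfl, hl, rfl⟩
      obtain ⟨hb, hd⟩ := hexp l Δ rfl (by omega)
      refine ⟨l, Δ, rfl, rfl, hb, hd, fun Λ hΛ => ?_⟩
      -- A child lies at most one level deeper, and that level contributes no new label.
      rw [hWk]
      obtain ⟨Z, rfl⟩ := Sequent.exists_eq_add_bracket hΛ
      exact ⟨l ++ [Z], Λ, (Sequent.plug_append_singleton _ _ _).symm, by simp; omega, rfl⟩)
    (n := Γ.weight) (fun l Δ hΔ hl => ⟨l, Δ, hΔ, by omega, rfl⟩) hE le_rfl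
  exact ⟨S, hne, hS, R, hR, hf.not_validInFrame⟩

end NestedSequents

theorem mainTheorem1 {P : Type u} [Nonempty P] (X : Set NestedSequents.ModalAxiom)
    (hX : NestedSequents.FourFiveClosed.{v} X) (Γ : NestedSequents.Sequent P) :
    (NestedSequents.Sequent.IsValid.{u, v} X Γ → NestedSequents.Provable X Γ) ∧
    (NestedSequents.ProveFails X Γ →
      ∃ (S : Type v) (_ : Nonempty S) (_ : Finite S) (R : S → S → Prop),
        NestedSequents.IsFrame X R ∧ ¬ Γ.ValidInFrame R) := by
  refine ⟨fun hvalid => ?_, fun h => h.exists_countermodel hX⟩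
  by_contra h
  obtain ⟨S, _, _, R, hR, hS⟩ := NestedSequents.exists_countermodel_of_not_provable hX h
  exact hS (hvalid S R hR)
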